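/- Let $1<p<\infty$ and put $\lambda_p=\dfrac{(2\pi)^p(p-1)}{[p\sin(\pi/p)]^p}$. There is exactly one function $\omega:\mathbb R\to\mathbb R$ such that $\omega$ and $|\omega'|^{p-2}\omega'$ are differentiable on $\mathbb R$ and $$-\left(|\omega'|^{p-2}\omega'\right)'=|\omega|^{p-2}\omega\ \text{ in }\mathbb R,\qquad \omega(0)=0,\quad \omega'(0)=1$$ (where $|x|^{p-2}x:=0$ for $x=0$). Let $N\in\mathbb N$, $\Lambda>0$, and suppose that $\mathbf u\not\equiv 0$, with values in $\mathbb R^N$, solves $$-\left(|\mathbf u'|^{p-2}\mathbf u'\right)'=\Lambda|\mathbf u|^{p-2}\mathbf u\ \text{ in }(0,1),\qquad \mathbf u(0)=\mathbf u(1)=0,$$ either classically ($\mathbf u$ is continuous on $[0,1]$ and vanishes at $0$ and $1$, $\mathbf u$ and $|\mathbf u'|^{p-2}\mathbf u'$ are differentiable in $(0,1)$, and the equation holds at every point of $(0,1)$) or weakly ($\mathbf u\in W^{1,p}_0((0,1);\mathbb R^N)$, the closure of $C_c^\infty((0,1);\mathbb R^N)$ in $W^{1,p}$, and $\int_0^1|\mathbf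 u'|^{p-2}\mathbf u'\cdot\varphi'\,dt=\Lambda\int_0^1|\mathbf u|^{p-2}\mathbf u\cdot\varphi\,dt$ for all $\varphi\in C_c^\infty((0,1);\mathbb R^N)$). Then $\Lambda=k^p\lambda_p$ for some integer $k\ge 1$, and there is $\mathbf c\in\mathbb R^N$ with $$\mathbf u(t)=\frac{\mathbf c}{\Lambda^{1/p}}\,\omega\!\left(\Lambda^{1/p}t\right)$$ for all $t\in[0,1]$ if $\mathbf u$ is a classical solution, and for almost every $t\in(0,1)$ if it is a weak one. Moreover $t\mapsto\omega(\Lambda^{1/p}t)$ is itself a (classical, respectively weak) solution of the same problem with $N=1$ and the same $\Lambda$; so every eigenfunction, not only every minimizer, is a constant vector times a scalar eigenfunction. -/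

import Mathlib

open MeasureTheory Set Filter Topology

namespace VectorPLaplace

variable {E : Type*} [NormedAddCommGroup E] [InnerProductSpace ℝ E]

/-- The map `x ↦ |x|^(p-2) x`. For `p > 1` it takes the value `0` at `x = 0`, whatever the value
of the real power `0 ^ (p - 2)`, so it is the usual continuous map. -/
noncomputable def phi (p : ℝ) (x : E) : E := ‖x‖ ^ (p - 2) • x

/-- The number `λ_p = (2π)^p (p - 1) / (p sin (π / p))^p`. -/
noncomputable def lam (p : ℝ) : ℝ :=
  (2 * Real.pi) ^ p * (p - 1) / (p * Real.sin (Real.pi / p)) ^ p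

/-- `ω : ℝ → ℝ` is a solution on the whole line of
`-(|ω'|^(p-2) ω')' = |ω|^(p-2) ω`, `ω(0) = 0`, `ω'(0) = 1`. -/
structure IsOmega (p : ℝ) (ω : ℝ → ℝ) : Prop where
  differentiable : Differentiable ℝ ω
  ode : ∀ t : ℝ, HasDerivAt (fun s => phi p (deriv ω s)) (-phi p (ω t)) t
  zero : ω 0 = 0
  deriv_zero : deriv ω 0 = 1

/-- Classical solutions of `-(|u'|^(p-2) u')' = Λ |u|^(p-2) u` in `(0,1)`, `u(0) = u(1) = 0`.
Only the values of `u` on `[0,1]` matter. -/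
structure IsClassicalSolution (p Λ : ℝ) (u : ℝ → E) : Prop where
  continuousOn : ContinuousOn u (Icc 0 1)
  differentiableAt : ∀ t ∈ Ioo (0 : ℝ) 1, DifferentiableAt ℝ u t
  ode : ∀ t ∈ Ioo (0 : ℝ) 1, HasDerivAt (fun s => phi p (deriv u s)) (-(Λ • phi p (u t))) t
  left : u 0 = 0
  right : u 1 = 0

/-- Test functions: `C_c^∞((0,1); E)`. -/
structure IsTestFunction (φ : ℝ → E) : Prop where
  smooth : ContDiff ℝ (⊤ : ℕ∞) φ
  hasCompactSupport : HasCompactSupport φ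
  tsupport_subset : tsupport φ ⊆ Ioo 0 1

/-- Lebesgue measure on the interval `(0,1)`. -/
noncomputable def unitMeasure : Measure ℝ := volume.restrict (Ioo 0 1)

/-- `g` is the weak derivative of `u` in `(0,1)`. -/
structure HasWeakDeriv (u g : ℝ → E) : Prop where
  locallyIntegrableOn : LocallyIntegrableOn u (Ioo 0 1)
  locallyIntegrableOn_deriv : LocallyIntegrableOn g (Ioo 0 1)
  integral_eq : ∀ φ : ℝ → ℝ, IsTestFunction φ →
    ∫ t, deriv φ t • u t ∂unitMeasure = -∫ t, φ t • g t ∂unitMeasure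

/-- `u` belongs to `W_0^{1,p}((0,1); E)`, the closure of the test functions in `W^{1,p}`, and its
weak derivative is `g`. -/
structure MemSobolevZero (p : ℝ) (u g : ℝ → E) : Prop where
  memLp : MemLp u (ENNReal.ofReal p) unitMeasure
  memLp_deriv : MemLp g (ENNReal.ofReal p) unitMeasure
  hasWeakDeriv : HasWeakDeriv u g
  approx : ∃ φ : ℕ → ℝ → E, (∀ n, IsTestFunction (φ n)) ∧
    Tendsto (fun n => eLpNorm (fun t => φ n t - u t) (ENNReal.ofReal p) unitMeasure)
      atTop (𝓝 0) ∧
    Tendsto (fun n => eLpNorm (fun t => deriv (φ n) t - g t) (ENNReal.ofReal p) unitMeasure)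
      atTop (𝓝 0)

/-- Weak solutions `u ∈ W_0^{1,p}((0,1); E)` of the Dirichlet eigenvalue problem:
`∫ |u'|^(p-2) u' · φ' = Λ ∫ |u|^(p-2) u · φ` for all test functions `φ`. -/
def IsWeakSolution (p Λ : ℝ) (u : ℝ → E) : Prop :=
  ∃ g : ℝ → E, MemSobolevZero p u g ∧ ∀ φ : ℝ → E, IsTestFunction φ →
    ∫ t, inner ℝ (phi p (g t)) (deriv φ t) ∂unitMeasure =
      Λ * ∫ t, inner ℝ (phi p (u t)) (φ t) ∂unitMeasure

end VectorPLaplace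

/-! With `w = |u'|^(p-2) u'` and the conjugate exponent `q`, `(p - 1) * (q - 1) = 1`, the maps `phi
p` and `phi q` are mutually inverse, and the equation becomes the system `u' = φ_q(w)`, `w' = -Λ
φ_p(u)`. The theorem is a rigidity statement for its initial value problem. A solution with `u 0 =
0` is determined by the vector `w 0`. With `μ = Λ^(1/p)` and `c = φ_q(w 0)`, the function `μ⁻¹ ω(μ
t) c` starts from the same data, so it is the solution (`IsFlow.exists_eq_smul_omega`).

The difficulty is uniqueness (`IsFlow.unique`), since `phi p` or `phi q` fails to be Lipschitz at
the origin unless `p = 2`. Energy conservation shows that a nontrivial flow never has `u = w = 0`.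
Where `u` vanishes, it leaves zero linearly in time, so the Lipschitz constant of `phi p` along it
is at most of order `1 / (t - a)`; the difference of two flows gains a factor `t - a` in `u`, which
compensates. Where `w` vanishes, the roles are exchanged.

The eigenvalues come from the zeros of `ω`. The scalar flow is written explicitly by an angle on its
energy curve (`exists_scalar_flow`); half a turn takes the time `P`, a beta integral evaluated by
the reflection formula, with `P ^ p = lam p`. If `u` is nonzero then `u 1 = 0` forces `ω(μ) = 0`, so
`μ = k P`.

Both notions of solution reduce to flows on `[0, 1]`: classical ones by extending `w` to the
endpoints, weak ones by the lemma of du Bois-Reymond. Conversely, the rescaled `ω` is a weak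
solution because a `C^1` function vanishing at `0` and `1` is a limit of test functions. -/

namespace VectorPLaplace

variable {E : Type*} [NormedAddCommGroup E] [InnerProductSpace ℝ E]

/-! ### Algebra and regularity of the map `x ↦ |x|^(p-2) x`. -/

section Phi

@[simp] lemma phi_zero (p : ℝ) : phi p (0 : E) = 0 := by simp [phi]

lemma phi_neg (p : ℝ) (x : E) : phi p (-x) = -phi p x := by simp [phi]

lemma phi_two (x : E) : phi 2 x = x := by simp [phi]

lemma phi_one_real (p : ℝ) : phi p (1 : ℝ) = 1 := by simp [phi]

lemma phi_smul (p r : ℝ) (x : E) : phi p (r • x) = phi p r • phi p x := by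
  simp only [phi, norm_smul, Real.mul_rpow (norm_nonneg r) (norm_nonneg x), smul_smul, smul_eq_mul]
  congr 1
  ring

lemma phi_of_pos (p : ℝ) {r : ℝ} (hr : 0 < r) : phi p r = r ^ (p - 1) := by
  rw [phi, Real.norm_of_nonneg hr.le, smul_eq_mul, show p - 1 = p - 2 + 1 by ring,
    Real.rpow_add_one hr.ne']

lemma norm_phi {p : ℝ} (hp : 1 < p) (x : E) : ‖phi p x‖ = ‖x‖ ^ (p - 1) := by
  rcases eq_or_ne x 0 with rfl | hx
  · simp [Real.zero_rpow (sub_pos.2 hp).ne']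
  · rw [phi, norm_smul, Real.norm_of_nonneg (by positivity), show p - 1 = p - 2 + 1 by ring,
      Real.rpow_add_one (norm_ne_zero_iff.2 hx)]

/-- Since `phi b` raises the norm to the power `b - 1` and keeps the direction, the shifted
exponents multiply under composition. For conjugate exponents the product is `1`, which makes the
two maps inverse to each other. -/
lemma phi_phi (a b : ℝ) (x : E) : phi a (phi b x) = phi ((a - 1) * (b - 1) + 1) x := by
  rcases eq_or_ne x 0 with rfl | hx
  · simp
  · have h0 : 0 < ‖x‖ := norm_pos_iff.2 hx
    have h1 : ‖phi b x‖ = ‖x‖ ^ (b - 1) := by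
      rw [phi, norm_smul, Real.norm_of_nonneg (by positivity), show b - 1 = b - 2 + 1 by ring,
        Real.rpow_add_one h0.ne']
    rw [phi, h1, phi, phi, smul_smul, ← Real.rpow_mul h0.le, ← Real.rpow_add h0]
    congr 2
    ring

lemma phi_phi_cancel {a b : ℝ} (h : (a - 1) * (b - 1) = 1) (x : E) : phi a (phi b x) = x := by
  rw [phi_phi, h, one_add_one_eq_two, phi_two]

lemma phi_eq_zero {p : ℝ} {x : E} : phi p x = 0 ↔ x = 0 := by
  refine ⟨fun h => ?_, fun h => by simp [h]⟩
  rcases smul_eq_zero.1 h with h | h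
  · by_contra hx
    exact (Real.rpow_pos_of_pos (norm_pos_iff.2 hx) (p - 2)).ne' h
  · exact h

lemma contDiffAt_phi (p : ℝ) {x : E} (hx : x ≠ 0) : ContDiffAt ℝ 1 (phi p) x := by
  have h1 : ContDiffAt ℝ 1 (fun y : E => ‖y‖ ^ (p - 2)) x :=
    (contDiffAt_norm ℝ hx).rpow_const_of_ne (norm_ne_zero_iff.2 hx)
  exact h1.smul contDiffAt_id

lemma continuous_phi {p : ℝ} (hp : 1 < p) : Continuous (phi p : E → E) := by
  refine continuous_iff_continuousAt.2 fun x => ?_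
  rcases eq_or_ne x 0 with rfl | hx
  · rw [ContinuousAt, phi_zero, tendsto_zero_iff_norm_tendsto_zero]
    simp only [norm_phi hp]
    have : ContinuousAt (fun y : E => ‖y‖ ^ (p - 1)) 0 :=
      continuous_norm.continuousAt.rpow_const (Or.inr (sub_pos.2 hp).le)
    simpa [ContinuousAt, Real.zero_rpow (sub_pos.2 hp).ne'] using this
  · exact (contDiffAt_phi p hx).continuousAt

lemma exists_lipschitz_phi (p : ℝ) {x : E} (hx : x ≠ 0) :
    ∃ K : ℝ, 0 ≤ K ∧ ∃ s ∈ 𝓝 x, ∀ y ∈ s, ∀ z ∈ s, ‖phi p y - phi p z‖ ≤ K * ‖y - z‖ := by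
  obtain ⟨K, s, hs, h⟩ := (contDiffAt_phi p hx).exists_lipschitzOnWith
  exact ⟨K, K.2, s, hs, fun y hy z hz => h.norm_sub_le hy hz⟩

end Phi

/-! ### The first order system and uniqueness for its initial value problem. -/

section Flow

/-- A solution on `[a, b]`, with one-sided derivatives, of the first order system
`u' = α φ_q(w)`, `w' = -β φ_p(u)`. -/
structure IsFlow (p q α β : ℝ) (u w : ℝ → E) (a b : ℝ) : Prop where
  cont_fst : ContinuousOn u (Icc a b)
  cont_snd : ContinuousOn w (Icc a b)
  deriv_fst : ∀ t ∈ Ico a b, HasDerivWithinAt u (α • phi q (w t)) (Ici t) t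
  deriv_snd : ∀ t ∈ Ico a b, HasDerivWithinAt w (-(β • phi p (u t))) (Ici t) t

variable {p q α β a b : ℝ} {u w u₁ w₁ u₂ w₂ : ℝ → E}

/-- The quarter turn `(u, w) ↦ (w, -u)` preserves the form of the system because `phi` is odd. The
coefficient `α` is carried for the sake of this symmetry; the flows of the theorem have `α = 1`. -/
lemma IsFlow.swap (h : IsFlow p q α β u w a b) : IsFlow q p β α w (fun t => -u t) a b where
  cont_fst := h.cont_snd
  cont_snd := h.cont_fst.neg
  deriv_fst t ht := by simpa [phi_neg] using h.deriv_snd t ht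
  deriv_snd t ht := (h.deriv_fst t ht).fun_neg

lemma IsFlow.mono (h : IsFlow p q α β u w a b) {c d : ℝ} (hc : a ≤ c) (hd : d ≤ b) :
    IsFlow p q α β u w c d where
  cont_fst := h.cont_fst.mono (Icc_subset_Icc hc hd)
  cont_snd := h.cont_snd.mono (Icc_subset_Icc hc hd)
  deriv_fst t ht := h.deriv_fst t (Ico_subset_Ico hc hd ht)
  deriv_snd t ht := h.deriv_snd t (Ico_subset_Ico hc hd ht)

/-- Conservation of energy. -/
lemma IsFlow.energy_eq (h : IsFlow p q α β u w a b) (hp : 1 < p) (hq : 1 < q) {t : ℝ}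
    (ht : t ∈ Icc a b) :
    α / q * ‖w t‖ ^ q + β / p * ‖u t‖ ^ p = α / q * ‖w a‖ ^ q + β / p * ‖u a‖ ^ p := by
  refine constant_of_has_deriv_right_zero
    (f := fun t => α / q * ‖w t‖ ^ q + β / p * ‖u t‖ ^ p) ?_ ?_ t ht
  · have hp0 : 0 ≤ p := by linarith
    have hq0 : 0 ≤ q := by linarith
    exact ((h.cont_snd.norm.rpow_const fun _ _ => Or.inr hq0).const_mul _).add
      ((h.cont_fst.norm.rpow_const fun _ _ => Or.inr hp0).const_mul _)
  · intro s hs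
    -- The two terms have derivatives `∓ α β ‖w‖^(q-2) ‖u‖^(p-2) ⟨u, w⟩`, which cancel.
    have h1 := ((hasFDerivAt_norm_rpow (w s) hq).comp_hasDerivWithinAt s
      (h.deriv_snd s hs)).const_mul (α / q)
    have h2 := ((hasFDerivAt_norm_rpow (u s) hp).comp_hasDerivWithinAt s
      (h.deriv_fst s hs)).const_mul (β / p)
    convert! h1.add h2 using 1
    have hp0 : p ≠ 0 := by linarith
    have hq0 : q ≠ 0 := by linarith
    simp only [phi, _root_.smul_apply, innerSL_apply_apply, inner_neg_right,
      inner_smul_right, smul_eq_mul, real_inner_comm (u s) (w s)]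
    field_simp
    ring

/-- Both terms of the energy are nonnegative, so zero energy forces both components to vanish. The
time `s` is arbitrary: a nontrivial flow cannot reach the origin later either. -/
lemma IsFlow.eq_zero (h : IsFlow p q α β u w a b) (hp : 1 < p) (hq : 1 < q) (hα : 0 < α)
    (hβ : 0 < β) {s : ℝ} (hs : s ∈ Icc a b) (h1 : u s = 0) (h2 : w s = 0) {t : ℝ}
    (ht : t ∈ Icc a b) : u t = 0 ∧ w t = 0 := by
  have hp0 : 0 < p := by linarith
  have hq0 : 0 < q := by linarith
  have e := (h.energy_eq hp hq ht).trans (h.energy_eq hp hq hs).symm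
  rw [h1, h2, norm_zero, Real.zero_rpow hq0.ne', Real.zero_rpow hp0.ne', mul_zero,
    mul_zero, add_zero] at e
  have e1 : 0 ≤ α / q * ‖w t‖ ^ q := by positivity
  have e2 : 0 ≤ β / p * ‖u t‖ ^ p := by positivity
  constructor
  · by_contra hne
    have : 0 < ‖u t‖ := norm_pos_iff.2 hne
    have : 0 < β / p * ‖u t‖ ^ p := by positivity
    linarith
  · by_contra hne
    have : 0 < ‖w t‖ := norm_pos_iff.2 hne
    have : 0 < α / q * ‖w t‖ ^ q := by positivity
    linarith

/-- Two flows which start at the same point agree for a short time, provided that `φ_q` is Lipschitz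
along them and the Lipschitz constant of `φ_p` grows at most like `1 / (t - a)`. -/
lemma IsFlow.eqOn_of_lipschitz (h₁ : IsFlow p q α β u₁ w₁ a b) (h₂ : IsFlow p q α β u₂ w₂ a b)
    (hu : u₁ a = u₂ a) (hw : w₁ a = w₂ a) {K L : ℝ} (hK : 0 ≤ K) (hL : 0 ≤ L)
    (hab : a ≤ b) (hsmall : (|β| * K) * (|α| * L) * (b - a) < 1)
    (hq : ∀ t ∈ Icc a b, ‖phi q (w₁ t) - phi q (w₂ t)‖ ≤ L * ‖w₁ t - w₂ t‖)
    (hp : ∀ t ∈ Icc a b, (t - a) * ‖phi p (u₁ t) - phi p (u₂ t)‖ ≤ K * ‖u₁ t - u₂ t‖) :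
    u₁ b = u₂ b ∧ w₁ b = w₂ b := by
  -- A contraction argument on `M = max ‖w₁ - w₂‖`: the first equation bounds `‖u₁ - u₂‖` by a
  -- multiple of `M (t - a)`, the factor `t - a` absorbs the blow-up in `hp`, and the second
  -- equation returns a bound `C (b - a) M` with `C (b - a) < 1`.
  obtain ⟨m, hm, hmax⟩ := isCompact_Icc.exists_isMaxOn (nonempty_Icc.2 hab)
    (h₁.cont_snd.sub h₂.cont_snd).norm
  set M := ‖w₁ m - w₂ m‖ with hM
  have hM0 : 0 ≤ M := norm_nonneg _
  have hmax' : ∀ t ∈ Icc a b, ‖w₁ t - w₂ t‖ ≤ M := fun t ht => hmax ht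
  have hub : ∀ t ∈ Icc a b, ‖u₁ t - u₂ t‖ ≤ |α| * L * M * (t - a) := by
    intro t ht
    have := norm_image_sub_le_of_norm_deriv_right_le_segment (f := fun t => u₁ t - u₂ t)
      (f' := fun t => α • phi q (w₁ t) - α • phi q (w₂ t)) (C := |α| * L * M)
      (h₁.cont_fst.sub h₂.cont_fst)
      (fun s hs => (h₁.deriv_fst s hs).sub (h₂.deriv_fst s hs)) (fun s hs => by
        have hs' := Ico_subset_Icc_self hs
        rw [← smul_sub, norm_smul, Real.norm_eq_abs, mul_assoc]
        exact mul_le_mul_of_nonneg_left ((hq s hs').trans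
          (mul_le_mul_of_nonneg_left (hmax' s hs') hL)) (abs_nonneg _)) t ht
    simpa [hu] using this
  have hwb : ∀ t ∈ Icc a b, ‖w₁ t - w₂ t‖ ≤ |β| * (K * (|α| * L * M)) * (t - a) := by
    intro t ht
    have := norm_image_sub_le_of_norm_deriv_right_le_segment (f := fun t => w₁ t - w₂ t)
      (f' := fun t => -(β • phi p (u₁ t)) - -(β • phi p (u₂ t)))
      (C := |β| * (K * (|α| * L * M)))
      (h₁.cont_snd.sub h₂.cont_snd)
      (fun s hs => (h₁.deriv_snd s hs).sub (h₂.deriv_snd s hs)) (fun s hs => by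
        have hs' := Ico_subset_Icc_self hs
        rw [neg_sub_neg, ← smul_sub, norm_smul, Real.norm_eq_abs, norm_sub_rev]
        refine mul_le_mul_of_nonneg_left ?_ (abs_nonneg _)
        -- At `s = a` the hypothesis `hp` says nothing, and the equality of the initial values is
        -- used instead.
        rcases hs.1.eq_or_lt with rfl | hlt
        · rw [hu, sub_self, norm_zero]
          positivity
        · have h3 := (hp s hs').trans (mul_le_mul_of_nonneg_left (hub s hs') hK)
          refine le_of_mul_le_mul_left (h3.trans (le_of_eq ?_)) (sub_pos.2 hlt)
          ring) t ht
    simpa [hw] using this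
  have hM1 : M = 0 := by
    by_contra hne
    have hpos : 0 < M := lt_of_le_of_ne hM0 (Ne.symm hne)
    have h4 := hwb m hm
    have h5 : |β| * (K * (|α| * L * M)) * (m - a) ≤ |β| * (K * (|α| * L * M)) * (b - a) :=
      mul_le_mul_of_nonneg_left (by linarith [hm.2]) (by positivity)
    have h6 : (|β| * K) * (|α| * L) * (b - a) * M < 1 * M := mul_lt_mul_of_pos_right hsmall hpos
    rw [← hM] at h4
    linarith
  have hb : b ∈ Icc a b := right_mem_Icc.2 hab
  constructor
  · have := hub b hb
    rw [hM1, mul_zero, zero_mul] at this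
    exact sub_eq_zero.1 (norm_le_zero_iff.1 this)
  · have := hmax' b hb
    rw [hM1] at this
    exact sub_eq_zero.1 (norm_le_zero_iff.1 this)

lemma tendsto_slope_of_hasDerivWithinAt_Ici {f : ℝ → E} {v : E}
    (h : HasDerivWithinAt f v (Ici a) a) (hf : f a = 0) :
    Tendsto (fun t => (t - a)⁻¹ • f t) (𝓝[>] a) (𝓝 v) := by
  have := (hasDerivWithinAt_iff_tendsto_slope' (lt_irrefl a)).1 (h.mono Ioi_subset_Ici_self)
  refine this.congr fun t => ?_
  simp [slope_def_module, hf]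

/-- Along two flows which start at the same nonzero point, the Lipschitz constant of `φ_p` blows up
at most like `1 / (t - a)`. -/
lemma IsFlow.eventually_lipschitz (h₁ : IsFlow p q α β u₁ w₁ a b)
    (h₂ : IsFlow p q α β u₂ w₂ a b) (hab : a < b) (hp : 1 < p) (hα : α ≠ 0)
    (hu : u₁ a = u₂ a) (hw : w₁ a = w₂ a) (hw0 : w₁ a ≠ 0) :
    ∃ K : ℝ, 0 ≤ K ∧ ∀ᶠ t in 𝓝[>] a,
      (t - a) * ‖phi p (u₁ t) - phi p (u₂ t)‖ ≤ K * ‖u₁ t - u₂ t‖ := by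
  have hsmall : ∀ᶠ t in 𝓝[>] a, t ∈ Ioo a (a + 1) := Ioo_mem_nhdsGT (by linarith)
  have ha : a ∈ Ico a b := ⟨le_rfl, hab⟩
  rcases eq_or_ne (u₁ a) 0 with hz | hz
  -- Both slopes `(t - a)⁻¹ u_i(t)` tend to the same nonzero vector, near which `phi p` is
  -- Lipschitz. By homogeneity the Lipschitz bound along the flows is `K (t - a)^(p-2)`, which is at
  -- most `K / (t - a)` because `p > 1` and `t - a < 1`.
  · have hv : α • phi q (w₁ a) ≠ 0 := smul_ne_zero hα (phi_eq_zero.not.2 hw0)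
    obtain ⟨K, hK, s, hs, hlip⟩ := exists_lipschitz_phi p hv
    have t₁ := tendsto_slope_of_hasDerivWithinAt_Ici (h₁.deriv_fst a ha) hz
    have t₂ := tendsto_slope_of_hasDerivWithinAt_Ici (h₂.deriv_fst a ha) (hu ▸ hz)
    rw [← hw] at t₂
    refine ⟨K, hK, ?_⟩
    filter_upwards [t₁ hs, t₂ hs, hsmall] with t ht₁ ht₂ ht
    have hpos : 0 < t - a := sub_pos.2 ht.1
    have key := hlip _ ht₁ _ ht₂
    rw [phi_smul, phi_smul, ← smul_sub, ← smul_sub, norm_smul, norm_smul,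
      norm_phi hp, Real.norm_of_nonneg (inv_nonneg.2 hpos.le), Real.inv_rpow hpos.le] at key
    have h1 : (t - a) ^ (p - 1) ≤ 1 :=
      Real.rpow_le_one hpos.le (by linarith [ht.2]) (by linarith)
    have h2 : 0 < (t - a) ^ (p - 1) := Real.rpow_pos_of_pos hpos _
    set X := ‖phi p (u₁ t) - phi p (u₂ t)‖
    have hX : X ≤ ((t - a) ^ (p - 1))⁻¹ * X :=
      le_mul_of_one_le_left (norm_nonneg _) ((one_le_inv₀ h2).2 h1)
    calc (t - a) * X ≤ (t - a) * (K * ((t - a)⁻¹ * ‖u₁ t - u₂ t‖)) :=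
          mul_le_mul_of_nonneg_left (hX.trans key) hpos.le
      _ = K * ‖u₁ t - u₂ t‖ := by field_simp
  · obtain ⟨K, hK, s, hs, hlip⟩ := exists_lipschitz_phi p hz
    have c₁ : Tendsto u₁ (𝓝[>] a) (𝓝 (u₁ a)) :=
      (h₁.deriv_fst a ha).continuousWithinAt.mono Ioi_subset_Ici_self
    have c₂ : Tendsto u₂ (𝓝[>] a) (𝓝 (u₁ a)) := hu ▸
      (h₂.deriv_fst a ha).continuousWithinAt.mono Ioi_subset_Ici_self
    refine ⟨K, hK, ?_⟩
    filter_upwards [c₁ hs, c₂ hs, hsmall] with t ht₁ ht₂ ht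
    calc (t - a) * ‖phi p (u₁ t) - phi p (u₂ t)‖ ≤ 1 * ‖phi p (u₁ t) - phi p (u₂ t)‖ :=
          mul_le_mul_of_nonneg_right (by linarith [ht.2]) (norm_nonneg _)
      _ ≤ K * ‖u₁ t - u₂ t‖ := by rw [one_mul]; exact hlip _ ht₁ _ ht₂

lemma IsFlow.exists_eq_of_snd_ne_zero (h₁ : IsFlow p q α β u₁ w₁ a b)
    (h₂ : IsFlow p q α β u₂ w₂ a b) (hab : a < b) (hp : 1 < p) (hα : α ≠ 0)
    (hu : u₁ a = u₂ a) (hw : w₁ a = w₂ a) (hw0 : w₁ a ≠ 0) :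
    ∃ c ∈ Ioc a b, u₁ c = u₂ c ∧ w₁ c = w₂ c := by
  obtain ⟨K, hK, hev⟩ := h₁.eventually_lipschitz h₂ hab hp hα hu hw hw0
  obtain ⟨L, hL, s, hs, hlip⟩ := exists_lipschitz_phi q hw0
  have ha : a ∈ Ico a b := ⟨le_rfl, hab⟩
  have c₁ : Tendsto w₁ (𝓝[>] a) (𝓝 (w₁ a)) :=
    (h₁.deriv_snd a ha).continuousWithinAt.mono Ioi_subset_Ici_self
  have c₂ : Tendsto w₂ (𝓝[>] a) (𝓝 (w₁ a)) := hw ▸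
    (h₂.deriv_snd a ha).continuousWithinAt.mono Ioi_subset_Ici_self
  have e₁ : ∀ᶠ t in 𝓝[>] a, w₁ t ∈ s := c₁ hs
  have e₂ : ∀ᶠ t in 𝓝[>] a, w₂ t ∈ s := c₂ hs
  obtain ⟨d, hd, hdd⟩ := mem_nhdsGT_iff_exists_Ioc_subset.1
    (hev.and (e₁.and e₂))
  have hC : 0 ≤ (|β| * K) * (|α| * L) := by positivity
  set C := (|β| * K) * (|α| * L) with hCdef
  obtain ⟨c, hca, hcb⟩ : ∃ c, a < c ∧ c < min (min d b) (a + 1 / (C + 1)) :=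
    exists_between (lt_min (lt_min hd hab) (by simp; positivity))
  have hcd : c ≤ d := hcb.le.trans ((min_le_left _ _).trans (min_le_left _ _))
  have hcb' : c ≤ b := hcb.le.trans ((min_le_left _ _).trans (min_le_right _ _))
  have hc1 : c - a < 1 / (C + 1) := by linarith [hcb.trans_le (min_le_right _ _)]
  refine ⟨c, ⟨hca, hcb'⟩, (h₁.mono le_rfl hcb').eqOn_of_lipschitz (h₂.mono le_rfl hcb') hu hw hK hL
    hca.le ?_ ?_ ?_⟩
  · rw [← hCdef]
    rw [lt_div_iff₀ (by linarith)] at hc1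
    nlinarith
  · intro t ht
    rcases ht.1.eq_or_lt with rfl | hlt
    · simp [hw]
    · exact hlip _ (hdd ⟨hlt, ht.2.trans hcd⟩).2.1 _ (hdd ⟨hlt, ht.2.trans hcd⟩).2.2
  · intro t ht
    rcases ht.1.eq_or_lt with rfl | hlt
    · simp [hu]
    · exact (hdd ⟨hlt, ht.2.trans hcd⟩).1

/-- Uniqueness for the initial value problem. -/
theorem IsFlow.unique (h₁ : IsFlow p q α β u₁ w₁ a b) (h₂ : IsFlow p q α β u₂ w₂ a b)
    (hp : 1 < p) (hq : 1 < q) (hα : 0 < α) (hβ : 0 < β)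
    (hu : u₁ a = u₂ a) (hw : w₁ a = w₂ a) {t : ℝ} (ht : t ∈ Icc a b) :
    u₁ t = u₂ t ∧ w₁ t = w₂ t := by
  have ha : a ∈ Icc a b := ⟨le_rfl, ht.1.trans ht.2⟩
  by_cases hz : u₁ a = 0 ∧ w₁ a = 0
  · obtain ⟨e1, e2⟩ := h₁.eq_zero hp hq hα hβ ha hz.1 hz.2 ht
    obtain ⟨e3, e4⟩ := h₂.eq_zero hp hq hα hβ ha (hu ▸ hz.1) (hw ▸ hz.2) ht
    exact ⟨e1.trans e3.symm, e2.trans e4.symm⟩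
  -- Continuation: the set of agreement is closed and contains `a`, so it remains to find further
  -- points of agreement immediately to the right of each of its points.
  have hcl : IsClosed ({t | u₁ t = u₂ t ∧ w₁ t = w₂ t} ∩ Icc a b) := by
    have e : {t | u₁ t = u₂ t ∧ w₁ t = w₂ t} ∩ Icc a b =
        Icc a b ∩ (fun t => (u₁ t - u₂ t, w₁ t - w₂ t)) ⁻¹' {0} := by
      ext t
      simp [sub_eq_zero, and_comm]
    rw [e]
    have hc := (h₁.cont_fst.sub h₂.cont_fst).prodMk (h₁.cont_snd.sub h₂.cont_snd)
    exact hc.preimage_isClosed_of_isClosed isClosed_Icc isClosed_singleton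
  refine hcl.Icc_subset_of_forall_exists_gt ⟨hu, hw⟩ ?_ ht
  rintro x ⟨⟨hxu, hxw⟩, hx⟩ y hy
  have hlt : x < min y b := lt_min hy hx.2
  have k₁ := h₁.mono hx.1 (min_le_right y b)
  have k₂ := h₂.mono hx.1 (min_le_right y b)
  have : ∃ c ∈ Ioc x (min y b), u₁ c = u₂ c ∧ w₁ c = w₂ c := by
    -- The local result needs a nonzero second component. If it vanishes, then `u₁ x ≠ 0` by
    -- conservation of energy, and the quarter turn puts `-u₁` in its place.
    by_cases hwx : w₁ x = 0
    · have hux : u₁ x ≠ 0 := fun h0 =>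
        hz (h₁.eq_zero hp hq hα hβ (Ico_subset_Icc_self hx) h0 hwx ha)
      obtain ⟨c, hc, e1, e2⟩ := k₁.swap.exists_eq_of_snd_ne_zero k₂.swap hlt hq hβ.ne' hxw
        (by simp [hxu]) (by simpa using hux)
      exact ⟨c, hc, neg_inj.1 e2, e1⟩
    · exact k₁.exists_eq_of_snd_ne_zero k₂ hlt hp hα.ne' hxu hxw hwx
  obtain ⟨c, hc, e⟩ := this
  exact ⟨c, e, hc.1, hc.2.trans (min_le_left _ _)⟩

end Flow

/-! ### Explicit scalar solution, its half-period and its zeros. -/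

section Construction

lemma hasDerivAt_phi_real (a : ℝ) {x : ℝ} (hx : x ≠ 0) :
    HasDerivAt (phi a) ((a - 1) * |x| ^ (a - 2)) x := by
  have key : ∀ y : ℝ, 0 < y → HasDerivAt (phi a) ((a - 1) * |y| ^ (a - 2)) y := by
    intro y hy
    have h := Real.hasDerivAt_rpow_const (x := y) (p := a - 1) (Or.inl hy.ne')
    rw [abs_of_pos hy, show a - 2 = a - 1 - 1 by ring]
    refine h.congr_of_eventuallyEq ?_
    filter_upwards [lt_mem_nhds hy] with z hz using phi_of_pos a hz
  rcases hx.lt_or_gt with h | h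
  · have h1 := (HasDerivAt.scomp x (key (-x) (neg_pos.2 h)) (hasDerivAt_neg x)).neg
    convert! h1 using 1
    · ext y
      simp [phi_neg]
    · simp
  · exact key x h

/-- The derivative of the time with respect to the angle, up to a constant factor, along the curve
`(|sin θ|^(2/p-1) sin θ, |cos θ|^(2/q-1) cos θ)`. -/
noncomputable def angularSpeed (p q θ : ℝ) : ℝ :=
  |Real.sin θ| ^ (2 / p - 1) * |Real.cos θ| ^ (2 / q - 1)

variable {p q : ℝ}

lemma measurable_angularSpeed (p q : ℝ) : Measurable (angularSpeed p q) := by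
  unfold angularSpeed
  fun_prop

lemma angularSpeed_nonneg (p q θ : ℝ) : 0 ≤ angularSpeed p q θ := by
  unfold angularSpeed
  positivity

lemma periodic_angularSpeed (p q : ℝ) : Function.Periodic (angularSpeed p q) Real.pi := by
  intro θ
  simp [angularSpeed, Real.sin_add_pi, Real.cos_add_pi]

lemma angularSpeed_pi_sub (p q θ : ℝ) : angularSpeed p q (Real.pi - θ) = angularSpeed p q θ := by
  simp [angularSpeed, Real.sin_pi_sub, Real.cos_pi_sub]

/-- The density of the beta distribution has total mass one; this gives integrability and the value
of the integral at once. -/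
lemma integral_beta {a b : ℝ} (ha : 0 < a) (hb : 0 < b) :
    IntegrableOn (fun x : ℝ => x ^ (a - 1) * (1 - x) ^ (b - 1)) (Ioo 0 1) ∧
    ∫ x in Ioo (0 : ℝ) 1, x ^ (a - 1) * (1 - x) ^ (b - 1) = ProbabilityTheory.beta a b := by
  have hB := ProbabilityTheory.beta_pos ha hb
  have h := ProbabilityTheory.lintegral_betaPDF_eq_one ha hb
  rw [ProbabilityTheory.lintegral_betaPDF] at h
  have hnn : 0 ≤ᵐ[volume.restrict (Ioo (0 : ℝ) 1)]
      fun x => 1 / ProbabilityTheory.beta a b * x ^ (a - 1) * (1 - x) ^ (b - 1) := by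
    refine ae_restrict_of_forall_mem measurableSet_Ioo fun x hx => ?_
    have h1 : 0 < x := hx.1
    have h2 : 0 < 1 - x := sub_pos.2 hx.2
    simp only [Pi.zero_apply]
    positivity
  have hm : Measurable fun x : ℝ =>
      1 / ProbabilityTheory.beta a b * x ^ (a - 1) * (1 - x) ^ (b - 1) := by fun_prop
  have hi : Integrable (fun x : ℝ =>
      1 / ProbabilityTheory.beta a b * x ^ (a - 1) * (1 - x) ^ (b - 1))
      (volume.restrict (Ioo (0 : ℝ) 1)) := by
    rw [← lintegral_ofReal_ne_top_iff_integrable hm.aestronglyMeasurable hnn, h]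
    simp
  have hv := integral_eq_lintegral_of_nonneg_ae hnn hm.aestronglyMeasurable
  rw [h, ENNReal.toReal_one] at hv
  have e : (fun x : ℝ => x ^ (a - 1) * (1 - x) ^ (b - 1)) = fun x => ProbabilityTheory.beta a b *
      (1 / ProbabilityTheory.beta a b * x ^ (a - 1) * (1 - x) ^ (b - 1)) := by
    ext x
    field_simp
  rw [e]
  refine ⟨hi.const_mul _, ?_⟩
  rw [integral_const_mul, hv, mul_one]

lemma image_sin_sq : (fun θ => Real.sin θ ^ 2) '' Ioo 0 (Real.pi / 2) = Ioo 0 1 := by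
  ext x
  constructor
  · rintro ⟨θ, hθ, rfl⟩
    have h1 : 0 < Real.sin θ := Real.sin_pos_of_pos_of_lt_pi hθ.1 (by linarith [hθ.2, Real.pi_pos])
    have h2 : 0 < Real.cos θ := Real.cos_pos_of_mem_Ioo ⟨by linarith [hθ.1, Real.pi_pos], hθ.2⟩
    have h3 := Real.sin_sq_add_cos_sq θ
    refine ⟨by positivity, ?_⟩
    show Real.sin θ ^ 2 < 1
    nlinarith
  · rintro ⟨h0, h1⟩
    have h2 : 0 < √x := Real.sqrt_pos.2 h0
    have h3 : √x < 1 := by rw [Real.sqrt_lt' one_pos]; simpa using h1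
    refine ⟨Real.arcsin (√x), ⟨Real.arcsin_pos.2 h2, Real.arcsin_lt_pi_div_two.2 h3⟩, ?_⟩
    simp only
    rw [Real.sin_arcsin (by linarith) h3.le, Real.sq_sqrt h0.le]

lemma injOn_sin_sq : InjOn (fun θ => Real.sin θ ^ 2) (Ioo 0 (Real.pi / 2)) := by
  intro x hx y hy h
  have hx1 : 0 < Real.sin x := Real.sin_pos_of_pos_of_lt_pi hx.1 (by linarith [hx.2, Real.pi_pos])
  have hy1 : 0 < Real.sin y := Real.sin_pos_of_pos_of_lt_pi hy.1 (by linarith [hy.2, Real.pi_pos])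
  exact Real.injOn_sin ⟨by linarith [hx.1, Real.pi_pos], hx.2.le⟩
    ⟨by linarith [hy.1, Real.pi_pos], hy.2.le⟩ ((sq_eq_sq₀ hx1.le hy1.le).1 h)

/-- Substitute `x = sin² θ` in the beta integral. Integrability has to be transported along with the
value, because the integrand is unbounded near an end of the interval when `p > 2` or `q > 2`. -/
lemma integral_angularSpeed_quarter (hp : 0 < p) (hq : 0 < q) :
    IntegrableOn (angularSpeed p q) (Ioo 0 (Real.pi / 2)) ∧
    2 * ∫ θ in Ioo 0 (Real.pi / 2), angularSpeed p q θ = ProbabilityTheory.beta (1 / p) (1 / q) := by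
  have hb := integral_beta (a := 1 / p) (b := 1 / q) (by positivity) (by positivity)
  have hd : ∀ θ ∈ Ioo 0 (Real.pi / 2), HasDerivWithinAt (fun θ => Real.sin θ ^ 2)
      (2 * Real.sin θ * Real.cos θ) (Ioo 0 (Real.pi / 2)) θ := by
    intro θ _
    simpa using ((Real.hasDerivAt_sin θ).fun_pow 2).hasDerivWithinAt
  have heq : EqOn (fun θ => |2 * Real.sin θ * Real.cos θ| •
      ((Real.sin θ ^ 2) ^ (1 / p - 1) * (1 - Real.sin θ ^ 2) ^ (1 / q - 1)))
      (fun θ => 2 * angularSpeed p q θ) (Ioo 0 (Real.pi / 2)) := by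
    intro θ hθ
    have h1 : 0 < Real.sin θ := Real.sin_pos_of_pos_of_lt_pi hθ.1 (by linarith [hθ.2, Real.pi_pos])
    have h2 : 0 < Real.cos θ := Real.cos_pos_of_mem_Ioo ⟨by linarith [hθ.1, Real.pi_pos], hθ.2⟩
    have h3 : 1 - Real.sin θ ^ 2 = Real.cos θ ^ 2 := by linarith [Real.sin_sq_add_cos_sq θ]
    have e1 : ∀ {s : ℝ} (r : ℝ), 0 < s → (s ^ 2) ^ (1 / r - 1) = s ^ (2 / r - 1) * s⁻¹ := by
      intro s r hs
      rw [← Real.rpow_natCast, ← Real.rpow_mul hs.le, ← Real.rpow_neg_one, ← Real.rpow_add hs]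
      congr 1
      push_cast
      ring
    simp only [angularSpeed, h3, smul_eq_mul]
    rw [abs_of_pos (by positivity), abs_of_pos h1, abs_of_pos h2, e1 p h1, e1 q h2]
    field_simp
  have hI := integrableOn_image_iff_integrableOn_abs_deriv_smul measurableSet_Ioo hd injOn_sin_sq
    (fun x : ℝ => x ^ (1 / p - 1) * (1 - x) ^ (1 / q - 1))
  have hV := integral_image_eq_integral_abs_deriv_smul measurableSet_Ioo hd injOn_sin_sq
    (fun x : ℝ => x ^ (1 / p - 1) * (1 - x) ^ (1 / q - 1))
  rw [image_sin_sq] at hI hV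
  rw [integrableOn_congr_fun heq measurableSet_Ioo] at hI
  rw [hb.2, setIntegral_congr_fun measurableSet_Ioo heq, integral_const_mul] at hV
  refine ⟨?_, hV.symm⟩
  have := (hI.1 hb.1).const_mul (1 / 2)
  simpa [IntegrableOn] using this

/-- Here `1 / p + 1 / q = 1`, so the beta function is `Γ(1/p) Γ(1 - 1/p)`, and Euler's reflection
formula applies. -/
lemma beta_conj (hp : 1 < p) (hq : 1 < q) (hpq : (p - 1) * (q - 1) = 1) :
    ProbabilityTheory.beta (1 / p) (1 / q) = Real.pi / Real.sin (Real.pi / p) := by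
  have e : 1 / q = 1 - 1 / p := by
    field_simp
    linarith
  rw [ProbabilityTheory.beta, e, Real.Gamma_mul_Gamma_one_sub, add_sub_cancel, Real.Gamma_one,
    div_one, mul_one_div]

lemma intervalIntegrable_angularSpeed (hp : 0 < p) (hq : 0 < q) (a b : ℝ) :
    IntervalIntegrable (angularSpeed p q) volume a b := by
  have h1 : IntervalIntegrable (angularSpeed p q) volume 0 (Real.pi / 2) := by
    rw [intervalIntegrable_iff_integrableOn_Ioo_of_le (by positivity)]
    exact (integral_angularSpeed_quarter hp hq).1
  have h2 := h1.comp_sub_left Real.pi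
  simp only [angularSpeed_pi_sub, sub_zero] at h2
  rw [show Real.pi - Real.pi / 2 = Real.pi / 2 by ring] at h2
  exact (periodic_angularSpeed p q).intervalIntegrable₀ Real.pi_ne_zero (h1.trans h2.symm) a b

lemma integral_angularSpeed (hp : 1 < p) (hq : 1 < q) (hpq : (p - 1) * (q - 1) = 1) :
    ∫ θ in (0 : ℝ)..Real.pi, angularSpeed p q θ = Real.pi / Real.sin (Real.pi / p) := by
  have hp0 : 0 < p := by linarith
  have hq0 : 0 < q := by linarith
  have hi := intervalIntegrable_angularSpeed hp0 hq0
  rw [← intervalIntegral.integral_add_adjacent_intervals (hi 0 (Real.pi / 2))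
    (hi (Real.pi / 2) Real.pi), ← beta_conj hp hq hpq, ← (integral_angularSpeed_quarter hp0 hq0).2]
  have h2 := intervalIntegral.integral_comp_sub_left (a := 0) (b := Real.pi / 2)
    (angularSpeed p q) Real.pi
  simp only [angularSpeed_pi_sub, sub_zero] at h2
  rw [show Real.pi - Real.pi / 2 = Real.pi / 2 by ring] at h2
  rw [← h2, intervalIntegral.integral_of_le (by positivity), integral_Ioc_eq_integral_Ioo]
  ring

/-- These angles, multiples of `π / 2`, are where a factor of `angularSpeed` may vanish or be
singular. Countability makes them negligible both for integrals and for recovering derivatives of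
continuous functions. -/
lemma countable_sin_mul_cos_eq_zero : {θ : ℝ | Real.sin θ * Real.cos θ = 0}.Countable := by
  refine (countable_range fun n : ℤ => (n : ℝ) * Real.pi / 2).mono fun θ hθ => ?_
  have : Real.sin (2 * θ) = 0 := by
    rw [Real.sin_two_mul, mul_assoc, show Real.sin θ * Real.cos θ = 0 from hθ, mul_zero]
  obtain ⟨n, hn⟩ := Real.sin_eq_zero_iff.1 this
  exact ⟨n, by simp only; rw [hn]; ring⟩

lemma angularSpeed_pos {θ : ℝ} (h : Real.sin θ * Real.cos θ ≠ 0) : 0 < angularSpeed p q θ :=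
  mul_pos (Real.rpow_pos_of_pos (abs_pos.2 (left_ne_zero_of_mul h)) _)
    (Real.rpow_pos_of_pos (abs_pos.2 (right_ne_zero_of_mul h)) _)

lemma integral_angularSpeed_pos (hp : 0 < p) (hq : 0 < q) {a b : ℝ} (hab : a < b) :
    0 < ∫ θ in a..b, angularSpeed p q θ := by
  rw [intervalIntegral.integral_pos_iff_support_of_nonneg_ae
    (ae_of_all _ (angularSpeed_nonneg p q)) (intervalIntegrable_angularSpeed hp hq a b)]
  refine ⟨hab, ?_⟩
  have hsub : Ioc a b \ {θ : ℝ | Real.sin θ * Real.cos θ = 0} ⊆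
      Function.support (angularSpeed p q) ∩ Ioc a b :=
    fun θ hθ => ⟨(angularSpeed_pos hθ.2).ne', hθ.1⟩
  refine lt_of_lt_of_le ?_ (measure_mono hsub)
  rw [measure_sdiff_null (countable_sin_mul_cos_eq_zero.measure_zero volume)]
  simpa using hab

/-- A strictly increasing clock which runs at the given multiple of `angularSpeed`, as an order
isomorphism of the line. -/
lemma exists_clock (hp : 0 < p) (hq : 0 < q) {c : ℝ} (hc : 0 < c) :
    ∃ τ : ℝ ≃o ℝ, (∀ θ, τ θ = c * ∫ x in (0 : ℝ)..θ, angularSpeed p q x) ∧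
      ∀ θ, Real.sin θ * Real.cos θ ≠ 0 → HasDerivAt τ (c * angularSpeed p q θ) θ := by
  have hi := intervalIntegrable_angularSpeed hp hq
  set f : ℝ → ℝ := fun θ => c * ∫ x in (0 : ℝ)..θ, angularSpeed p q x with hf
  have hmono : StrictMono f := by
    intro a b hab
    have := integral_angularSpeed_pos hp hq hab
    rw [← intervalIntegral.integral_interval_sub_left (hi 0 b) (hi 0 a)] at this
    exact mul_lt_mul_of_pos_left (sub_pos.1 this) hc
  have hcont : Continuous f := (intervalIntegral.continuous_primitive hi 0).const_mul c
  have hpos := integral_angularSpeed_pos hp hq Real.pi_pos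
  -- The integrand is periodic with positive integral over a period, so its primitive is unbounded
  -- in both directions.
  have hsurj : Function.Surjective f := hcont.surjective
    (((periodic_angularSpeed p q).tendsto_atTop_intervalIntegral_of_pos hpos
      Real.pi_pos).const_mul_atTop hc)
    (((periodic_angularSpeed p q).tendsto_atBot_intervalIntegral_of_pos hpos
      Real.pi_pos).const_mul_atBot hc)
  refine ⟨hmono.orderIsoOfSurjective f hsurj, fun θ => rfl, fun θ hθ => ?_⟩
  have hca : ContinuousAt (angularSpeed p q) θ := by
    unfold angularSpeed
    exact (Real.continuous_sin.abs.continuousAt.rpow_const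
      (Or.inl (abs_pos.2 (left_ne_zero_of_mul hθ)).ne')).mul
      (Real.continuous_cos.abs.continuousAt.rpow_const
      (Or.inl (abs_pos.2 (right_ne_zero_of_mul hθ)).ne'))
  exact (intervalIntegral.integral_hasDerivAt_right (hi 0 θ)
    (measurable_angularSpeed p q).stronglyMeasurable.stronglyMeasurableAtFilter hca).const_mul c

/-- A continuous function whose derivative is a given continuous function off a countable set is
differentiable everywhere. -/
lemma hasDerivAt_of_off_countable {F : Type*} [NormedAddCommGroup F] [NormedSpace ℝ F]
    [CompleteSpace F] {f g : ℝ → F} {s : Set ℝ}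
    (hs : s.Countable) (hf : Continuous f) (hg : Continuous g)
    (h : ∀ x ∉ s, HasDerivAt f (g x) x) (x : ℝ) : HasDerivAt f (g x) x := by
  have e : f = fun t => f 0 + ∫ y in (0 : ℝ)..t, g y := by
    ext t
    rw [MeasureTheory.integral_eq_of_hasDerivAt_off_countable f g hs hf.continuousOn
      (fun y hy => h y hy.2) (hg.intervalIntegrable _ _)]
    abel
  rw [e]
  exact (hg.integral_hasStrictDerivAt 0 x).hasDerivAt.const_add _

/-- Existence of a global solution of the scalar first order system, with its zeros. -/
theorem exists_scalar_flow (hp : 1 < p) (hq : 1 < q) (hpq : (p - 1) * (q - 1) = 1) :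
    ∃ (u w : ℝ → ℝ) (P : ℝ), (∀ t, HasDerivAt u (phi q (w t)) t) ∧
      (∀ t, HasDerivAt w (-phi p (u t)) t) ∧ u 0 = 0 ∧ w 0 = 1 ∧ 0 < P ∧ P ^ p = lam p ∧
      ∀ t, u t = 0 → ∃ k : ℤ, t = k * P := by
  have hp0 : 0 < p := by linarith
  have hq0 : 0 < q := by linarith
  have hp1 : 0 < p - 1 := by linarith
  -- Below, `|u|^p = m^p sin² θ` and `|w|^q = cos² θ`. The choice `m^p = p - 1 = p / q` places the
  -- curve on the energy level `|w|^q / q + |u|^p / p = 1 / q`.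
  set m : ℝ := (p - 1) ^ (1 / p) with hm
  have hm0 : 0 < m := Real.rpow_pos_of_pos hp1 _
  have hmp : m ^ p = p - 1 := by
    rw [hm, ← Real.rpow_mul hp1.le, one_div_mul_cancel hp0.ne', Real.rpow_one]
  have hmq : q * m ^ p = p := by
    rw [hmp]
    linarith
  -- The factor `2 m / p` is read off from `u' = φ_q(w)`, which requires `dt/dθ = (2 m / p) |sin
  -- θ|^(2/p-1) |cos θ|^(2/q-1)`.
  obtain ⟨τ, hτ, hτ'⟩ := exists_clock hp0 hq0 (c := 2 * m / p) (by positivity)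
  have hθ : Continuous τ.symm := τ.symm.continuous
  have h1p : 1 < 2 / p + 1 := by linarith [div_pos two_pos hp0]
  have h1q : 1 < 2 / q + 1 := by linarith [div_pos two_pos hq0]
  have hτ0 : τ 0 = 0 := by simp [hτ]
  have hθ0 : τ.symm 0 = 0 := by rw [OrderIso.symm_apply_eq, hτ0]
  set u : ℝ → ℝ := fun t => m • phi (2 / p + 1) (Real.sin (τ.symm t)) with hu
  set w : ℝ → ℝ := fun t => phi (2 / q + 1) (Real.cos (τ.symm t)) with hw
  have hucont : Continuous u :=
    ((continuous_phi h1p).comp (Real.continuous_sin.comp hθ)).const_smul m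
  have hwcont : Continuous w := (continuous_phi h1q).comp (Real.continuous_cos.comp hθ)
  have hbad : (τ.symm ⁻¹' {θ : ℝ | Real.sin θ * Real.cos θ = 0}).Countable :=
    countable_sin_mul_cos_eq_zero.preimage τ.symm.injective
  have hθ' : ∀ t ∉ τ.symm ⁻¹' {θ : ℝ | Real.sin θ * Real.cos θ = 0},
      HasDerivAt τ.symm (2 * m / p * angularSpeed p q (τ.symm t))⁻¹ t := by
    intro t ht
    have := angularSpeed_pos (p := p) (q := q) ht
    exact (hτ' _ ht).of_local_left_inverse hθ.continuousAt (by positivity)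
      (Eventually.of_forall fun y => τ.apply_symm_apply y)
  -- `P` is the time `τ π` of half a turn. The differential equations are checked only off the
  -- countable set of exceptional times, since `u`, `w` and both right-hand sides are continuous.
  refine ⟨u, w, 2 * m / p * (Real.pi / Real.sin (Real.pi / p)),
    hasDerivAt_of_off_countable hbad hucont ((continuous_phi hq).comp hwcont) fun t ht => ?_,
    hasDerivAt_of_off_countable hbad hwcont ((continuous_phi hp).comp hucont).neg fun t ht => ?_,
    by simp [hu, hθ0], by simp [hw, hθ0, phi_one_real], ?_, ?_, ?_⟩
  · have hsin : Real.sin (τ.symm t) ≠ 0 := left_ne_zero_of_mul ht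
    have hcos : Real.cos (τ.symm t) ≠ 0 := right_ne_zero_of_mul ht
    have h1 := (((hasDerivAt_phi_real (2 / p + 1) hsin).comp t
      ((hθ' t ht).sin))).const_smul m
    convert! h1 using 1
    have hs : 0 < |Real.sin (τ.symm t)| := abs_pos.2 hsin
    have hc : 0 < |Real.cos (τ.symm t)| := abs_pos.2 hcos
    simp only [hw, phi_phi]
    rw [phi, angularSpeed, Real.norm_eq_abs, smul_eq_mul, smul_eq_mul,
      show (q - 1) * (2 / q + 1 - 1) + 1 - 2 = -(2 / q - 1) by field_simp; ring,
      show 2 / p + 1 - 2 = 2 / p - 1 by ring, Real.rpow_neg hc.le]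
    have := Real.rpow_pos_of_pos hs (2 / p - 1)
    have := Real.rpow_pos_of_pos hc (2 / q - 1)
    field_simp
    ring
  · have hsin : Real.sin (τ.symm t) ≠ 0 := left_ne_zero_of_mul ht
    have hcos : Real.cos (τ.symm t) ≠ 0 := right_ne_zero_of_mul ht
    have h1 := (hasDerivAt_phi_real (2 / q + 1) hcos).comp t ((hθ' t ht).cos)
    convert! h1 using 1
    have hs : 0 < |Real.sin (τ.symm t)| := abs_pos.2 hsin
    have hc : 0 < |Real.cos (τ.symm t)| := abs_pos.2 hcos
    have hm1 : m ^ (p - 1) = p / (q * m) := by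
      rw [Real.rpow_sub_one hm0.ne', eq_div_iff (by positivity)]
      field_simp
      linarith
    simp only [hu, phi_smul, phi_phi]
    rw [phi_of_pos p hm0, hm1, phi, angularSpeed, Real.norm_eq_abs, smul_eq_mul, smul_eq_mul,
      show (p - 1) * (2 / p + 1 - 1) + 1 - 2 = -(2 / p - 1) by field_simp; ring,
      show 2 / q + 1 - 2 = 2 / q - 1 by ring, Real.rpow_neg hs.le]
    have := Real.rpow_pos_of_pos hs (2 / p - 1)
    have := Real.rpow_pos_of_pos hc (2 / q - 1)
    field_simp
    ring
  · have : 0 < Real.sin (Real.pi / p) := Real.sin_pos_of_pos_of_lt_pi (by positivity)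
      (div_lt_self Real.pi_pos hp)
    positivity
  · have hs : 0 < Real.sin (Real.pi / p) := Real.sin_pos_of_pos_of_lt_pi (by positivity)
      (div_lt_self Real.pi_pos hp)
    have e : 2 * m / p * (Real.pi / Real.sin (Real.pi / p)) =
        (2 * Real.pi) * m / (p * Real.sin (Real.pi / p)) := by
      field_simp
    rw [e, Real.div_rpow (by positivity) (by positivity), Real.mul_rpow (by positivity) hm0.le,
      hmp, lam]
  · intro t ht
    have h0 : Real.sin (τ.symm t) = 0 := by
      rcases smul_eq_zero.1 ht with h | h
      · exact absurd h hm0.ne'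
      · exact phi_eq_zero.1 h
    obtain ⟨k, hk⟩ := Real.sin_eq_zero_iff.1 h0
    refine ⟨k, ?_⟩
    have h1 : t = τ (k * Real.pi) := by rw [hk, OrderIso.apply_symm_apply]
    -- The `π`-periodicity of the speed gives `τ (k π) = k τ π`.
    have h2 := (periodic_angularSpeed p q).intervalIntegral_add_zsmul_eq k 0
      (intervalIntegrable_angularSpeed hp0 hq0)
    rw [zero_add, zero_add, integral_angularSpeed hp hq hpq, zsmul_eq_mul, zsmul_eq_mul] at h2
    rw [h1, hτ, h2]
    ring

end Construction

/-! ### Global flows, `ω`, and rigidity of solutions starting at zero. -/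

section Identification

variable {p q : ℝ}

/-- A solution on the whole line of the first order system `u' = φ_q(w)`, `w' = -β φ_p(u)`. -/
structure IsGlobalFlow (p q β : ℝ) (u w : ℝ → E) : Prop where
  deriv_fst : ∀ t, HasDerivAt u (phi q (w t)) t
  deriv_snd : ∀ t, HasDerivAt w (-(β • phi p (u t))) t

namespace IsGlobalFlow

variable {β : ℝ} {u w u₁ w₁ u₂ w₂ : ℝ → E}

lemma continuous_fst (h : IsGlobalFlow p q β u w) : Continuous u :=
  continuous_iff_continuousAt.2 fun t => (h.deriv_fst t).continuousAt

lemma continuous_snd (h : IsGlobalFlow p q β u w) : Continuous w :=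
  continuous_iff_continuousAt.2 fun t => (h.deriv_snd t).continuousAt

lemma isFlow (h : IsGlobalFlow p q β u w) (a b : ℝ) : IsFlow p q 1 β u w a b where
  cont_fst := h.continuous_fst.continuousOn
  cont_snd := h.continuous_snd.continuousOn
  deriv_fst t _ := by simpa using (h.deriv_fst t).hasDerivWithinAt
  deriv_snd t _ := (h.deriv_snd t).hasDerivWithinAt

/-- Time reversal, by which forward uniqueness also covers negative times. -/
lemma reflect (h : IsGlobalFlow p q β u w) :
    IsGlobalFlow p q β (fun t => -u (-t)) (fun t => w (-t)) where
  deriv_fst t := by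
    simpa using (HasDerivAt.scomp t (h.deriv_fst (-t)) (hasDerivAt_neg t)).fun_neg
  deriv_snd t := by
    simpa [phi_neg, Function.comp_def] using HasDerivAt.scomp t (h.deriv_snd (-t)) (hasDerivAt_neg t)

lemma unique (h₁ : IsGlobalFlow p q β u₁ w₁) (h₂ : IsGlobalFlow p q β u₂ w₂) (hp : 1 < p)
    (hq : 1 < q) (hβ : 0 < β) (hu : u₁ 0 = u₂ 0) (hw : w₁ 0 = w₂ 0) : u₁ = u₂ := by
  ext t
  rcases le_total 0 t with ht | ht
  · exact ((h₁.isFlow 0 t).unique (h₂.isFlow 0 t) hp hq one_pos hβ hu hw ⟨ht, le_rfl⟩).1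
  · have := ((h₁.reflect.isFlow 0 (-t)).unique (h₂.reflect.isFlow 0 (-t)) hp hq one_pos hβ
      (by simp [hu]) (by simp [hw]) ⟨neg_nonneg.2 ht, le_rfl⟩).1
    simpa using this

/-- Rescaling in time and in space. -/
lemma rescale {u w : ℝ → ℝ} (h : IsGlobalFlow p q 1 u w) (hpq : (p - 1) * (q - 1) = 1) {μ : ℝ}
    (hμ : 0 < μ) (c : E) :
    IsGlobalFlow p q (μ ^ p) (fun t => u (μ * t) • (μ⁻¹ • c)) (fun t => w (μ * t) • phi p c) where
  deriv_fst t := by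
    have h1 := (HasDerivAt.scomp t (h.deriv_fst (μ * t)) (hasDerivAt_const_mul μ)).smul_const
      (μ⁻¹ • c)
    convert! h1 using 1
    rw [phi_smul, phi_phi_cancel (by rw [mul_comm]; exact hpq), smul_smul, smul_eq_mul]
    congr 1
    field_simp
  deriv_snd t := by
    have h1 := (HasDerivAt.scomp t (h.deriv_snd (μ * t)) (hasDerivAt_const_mul μ)).smul_const
      (phi p c)
    convert! h1 using 1
    rw [phi_smul, phi_smul, phi_of_pos p (inv_pos.2 hμ), smul_smul, smul_smul, ← neg_smul,
      smul_eq_mul, Real.inv_rpow hμ.le, Real.rpow_sub_one hμ.ne']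
    congr 1
    have := Real.rpow_pos_of_pos hμ p
    simp only [smul_eq_mul]
    field_simp

lemma isOmega {u w : ℝ → ℝ} (h : IsGlobalFlow p q 1 u w) (hpq : (p - 1) * (q - 1) = 1)
    (hu : u 0 = 0) (hw : w 0 = 1) : IsOmega p u where
  differentiable t := (h.deriv_fst t).differentiableAt
  ode t := by
    have e : (fun s => phi p (deriv u s)) = w := by
      ext s
      rw [(h.deriv_fst s).deriv, phi_phi_cancel hpq]
    rw [e]
    simpa using h.deriv_snd t
  zero := hu
  deriv_zero := by rw [(h.deriv_fst 0).deriv, hw, phi_one_real]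

lemma isClassicalSolution (h : IsGlobalFlow p q β u w) (hpq : (p - 1) * (q - 1) = 1)
    (h0 : u 0 = 0) (h1 : u 1 = 0) : IsClassicalSolution p β u where
  continuousOn := h.continuous_fst.continuousOn
  differentiableAt t _ := (h.deriv_fst t).differentiableAt
  ode t _ := by
    have e : (fun s => phi p (deriv u s)) = w := by
      ext s
      rw [(h.deriv_fst s).deriv, phi_phi_cancel hpq]
    rw [e]
    exact h.deriv_snd t
  left := h0
  right := h1

end IsGlobalFlow

lemma IsOmega.isGlobalFlow {ω : ℝ → ℝ} (h : IsOmega p ω) (hpq : (p - 1) * (q - 1) = 1) :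
    IsGlobalFlow p q 1 ω (fun t => phi p (deriv ω t)) where
  deriv_fst t := by
    rw [phi_phi_cancel (by rw [mul_comm]; exact hpq)]
    exact (h.differentiable t).hasDerivAt
  deriv_snd t := by simpa using h.ode t

/-- Every flow which starts at `u = 0` is a constant vector times the rescaled scalar flow. -/
lemma IsFlow.exists_eq_smul_omega {ω : ℝ → ℝ} (hω : IsOmega p ω) (hp : 1 < p) (hq : 1 < q)
    (hpq : (p - 1) * (q - 1) = 1) {μ b : ℝ} (hμ : 0 < μ) {u w : ℝ → E}
    (h : IsFlow p q 1 (μ ^ p) u w 0 b) (hu : u 0 = 0) :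
    ∃ c : E, ∀ t ∈ Icc 0 b, u t = ω (μ * t) • (μ⁻¹ • c) := by
  have hqp : (q - 1) * (p - 1) = 1 := by rw [mul_comm]; exact hpq
  -- This vector is the initial velocity `u'(0)`; the rescaled profile then has second component
  -- `phi p (phi q (w 0)) = w 0` at time `0`.
  refine ⟨phi q (w 0), fun t ht => ?_⟩
  refine (h.unique (((hω.isGlobalFlow hpq).rescale hpq hμ (phi q (w 0))).isFlow 0 b) hp hq one_pos
    (Real.rpow_pos_of_pos hμ p) ?_ ?_ ht).1
  · simp [hu, hω.zero]
  · simp [hω.deriv_zero, phi_one_real, phi_phi_cancel hpq]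

theorem existsUnique_isOmega (hp : 1 < p) (hq : 1 < q) (hpq : (p - 1) * (q - 1) = 1) :
    ∃! ω : ℝ → ℝ, IsOmega p ω := by
  obtain ⟨u, w, P, hu, hw, hu0, hw0, -, -, -⟩ := exists_scalar_flow hp hq hpq
  have h : IsGlobalFlow p q 1 u w := ⟨hu, fun t => by simpa using hw t⟩
  refine ⟨u, h.isOmega hpq hu0 hw0, fun v hv => ?_⟩
  exact (hv.isGlobalFlow hpq).unique h hp hq one_pos (hv.zero.trans hu0.symm)
    (by simp [hv.deriv_zero, phi_one_real, hw0])

/-- By uniqueness `ω` is the explicit scalar solution, whose zeros are multiples of `P`; positivity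
of `μ` excludes `k ≤ 0`. -/
lemma IsOmega.exists_pow_mul_lam {ω : ℝ → ℝ} (hω : IsOmega p ω) (hp : 1 < p) (hq : 1 < q)
    (hpq : (p - 1) * (q - 1) = 1) {μ : ℝ} (hμ : 0 < μ) (h : ω μ = 0) :
    ∃ k : ℕ, 0 < k ∧ μ ^ p = (k : ℝ) ^ p * lam p := by
  obtain ⟨u, w, P, hu, hw, hu0, hw0, hP, hPp, hz⟩ := exists_scalar_flow hp hq hpq
  have hf : IsGlobalFlow p q 1 u w := ⟨hu, fun t => by simpa using hw t⟩
  have e : ω = u := (existsUnique_isOmega hp hq hpq).unique hω (hf.isOmega hpq hu0 hw0)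
  obtain ⟨k, hk⟩ := hz μ (e ▸ h)
  have hk0 : 0 < k := by
    have : (0 : ℝ) < k := by
      by_contra hle
      have := mul_nonpos_of_nonpos_of_nonneg (not_lt.1 hle) hP.le
      linarith
    exact_mod_cast this
  lift k to ℕ using hk0.le
  refine ⟨k, by exact_mod_cast hk0, ?_⟩
  rw [hk, Int.cast_natCast, Real.mul_rpow (Nat.cast_nonneg k) hP.le, hPp]

/-- A classical solution of the boundary value problem is a flow on `[0, 1]`. -/
lemma IsClassicalSolution.exists_isFlow [CompleteSpace E] {Λ : ℝ} {u : ℝ → E}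
    (h : IsClassicalSolution p Λ u) (hp : 1 < p) (hq : 1 < q) (hpq : (p - 1) * (q - 1) = 1) :
    ∃ w : ℝ → E, IsFlow p q 1 Λ u w 0 1 := by
  -- The constant extension of `u` makes the right-hand side continuous on the line, so integrating
  -- it from the interior point `1 / 2` extends `phi p (u')` to the endpoints, where no derivative
  -- of `u` is assumed.
  set v : ℝ → E := IccExtend (zero_le_one' ℝ) ((Icc (0 : ℝ) 1).domRestrict u) with hv
  have hvc : Continuous v := (continuousOn_iff_continuous_domRestrict.1 h.continuousOn).Icc_extend'
  have hvu : ∀ t ∈ Icc (0 : ℝ) 1, v t = u t := fun t ht => IccExtend_of_mem _ _ ht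
  have hF : Continuous fun t => -(Λ • phi p (v t)) := (((continuous_phi hp).comp hvc).const_smul Λ).neg
  set w : ℝ → E := fun t => phi p (deriv u (1 / 2)) + ∫ s in (1 / 2 : ℝ)..t, -(Λ • phi p (v s))
    with hw
  have hw' : ∀ t, HasDerivAt w (-(Λ • phi p (v t))) t := fun t =>
    (hF.integral_hasStrictDerivAt (1 / 2) t).hasDerivAt.const_add _
  have hwc : Continuous w := continuous_iff_continuousAt.2 fun t => (hw' t).continuousAt
  have heq : EqOn (fun t => phi p (deriv u t)) w (Ioo 0 1) := by
    refine isOpen_Ioo.eqOn_of_deriv_eq isPreconnected_Ioo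
      (fun t ht => (h.ode t ht).differentiableAt.differentiableWithinAt)
      (fun t _ => (hw' t).differentiableAt.differentiableWithinAt) (fun t ht => ?_)
      (x := 1 / 2) ⟨by norm_num, by norm_num⟩ (by simp [hw])
    rw [(h.ode t ht).deriv, (hw' t).deriv, hvu t (Ioo_subset_Icc_self ht)]
  have hder : ∀ t ∈ Ioo (0 : ℝ) 1, deriv u t = phi q (w t) := fun t ht => by
    rw [← heq ht, phi_phi_cancel (by rw [mul_comm]; exact hpq)]
  refine ⟨w, h.continuousOn, hwc.continuousOn, fun t ht => ?_, fun t ht => ?_⟩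
  · rw [one_smul]
    rcases ht.1.eq_or_lt with rfl | hlt
    -- At `0` the right derivative exists because `u' = φ_q(w)` has a limit there.
    · refine hasDerivWithinAt_Ici_of_tendsto_deriv (s := Ioo 0 1)
        (fun t ht => (h.differentiableAt t ht).differentiableWithinAt)
        ((h.continuousOn 0 (by simp)).mono Ioo_subset_Icc_self) (Ioo_mem_nhdsGT one_pos) ?_
      have hc : Tendsto (fun t => phi q (w t)) (𝓝[>] 0) (𝓝 (phi q (w 0))) :=
        ((continuous_phi hq).comp hwc).continuousAt.mono_left nhdsWithin_le_nhds
      refine hc.congr' ?_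
      filter_upwards [Ioo_mem_nhdsGT one_pos] with t ht using (hder t ht).symm
    · rw [← hder t ⟨hlt, ht.2⟩]
      exact (h.differentiableAt t ⟨hlt, ht.2⟩).hasDerivAt.hasDerivWithinAt
  · rw [← hvu t (Ico_subset_Icc_self ht)]
    exact (hw' t).hasDerivWithinAt

end Identification

/-! ### Test functions and the lemma of du Bois-Reymond. -/

section TestFunctions

instance : IsProbabilityMeasure unitMeasure := ⟨by simp [unitMeasure]⟩

lemma integral_unitMeasure (f : ℝ → E) : ∫ t, f t ∂unitMeasure = ∫ t in (0 : ℝ)..1, f t := by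
  rw [unitMeasure, intervalIntegral.integral_of_le zero_le_one, integral_Ioc_eq_integral_Ioo]

lemma ae_unitMeasure {P : ℝ → Prop} (h : ∀ t ∈ Ioo (0 : ℝ) 1, P t) : ∀ᵐ t ∂unitMeasure, P t :=
  ae_restrict_of_forall_mem measurableSet_Ioo h

lemma intervalIntegrable_of_integrable_unitMeasure {F : Type*} [NormedAddCommGroup F]
    {f : ℝ → F} (h : Integrable f unitMeasure) {a b : ℝ} (ha : a ∈ Icc (0 : ℝ) 1) (hb : b ∈ Icc (0 : ℝ) 1) :
    IntervalIntegrable f volume a b := by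
  have h1 : IntervalIntegrable f volume 0 1 := by
    rw [intervalIntegrable_iff_integrableOn_Ioo_of_le zero_le_one]
    exact h
  refine h1.mono_set ?_
  rw [uIcc_of_le zero_le_one]
  exact uIcc_subset_Icc ha hb

lemma _root_.Continuous.memLp_unitMeasure {F : Type*} [NormedAddCommGroup F] {f : ℝ → F}
    (hf : Continuous f) (r : ENNReal) :
    MemLp f r unitMeasure := by
  obtain ⟨C, hC⟩ := isCompact_Icc.exists_bound_of_continuousOn (s := Icc (0 : ℝ) 1) hf.continuousOn
  exact MemLp.of_bound hf.aestronglyMeasurable C (ae_unitMeasure fun t ht =>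
    hC t (Ioo_subset_Icc_self ht))

lemma _root_.Continuous.integrable_unitMeasure {F : Type*} [NormedAddCommGroup F] {f : ℝ → F}
    (hf : Continuous f) :
    Integrable f unitMeasure :=
  memLp_one_iff_integrable.1 (hf.memLp_unitMeasure 1)

namespace IsTestFunction

variable {φ η : ℝ → E}

lemma continuous (h : IsTestFunction φ) : Continuous φ := h.smooth.continuous

lemma differentiable (h : IsTestFunction φ) : Differentiable ℝ φ :=
  h.smooth.differentiable (by simp)

lemma continuous_deriv (h : IsTestFunction φ) : Continuous (deriv φ) :=
  h.smooth.continuous_deriv (by exact_mod_cast le_top)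

lemma eq_zero_of_notMem (h : IsTestFunction φ) {t : ℝ} (ht : t ∉ Ioo (0 : ℝ) 1) : φ t = 0 :=
  image_eq_zero_of_notMem_tsupport fun h' => ht (h.tsupport_subset h')

lemma map_zero (h : IsTestFunction φ) : φ 0 = 0 := h.eq_zero_of_notMem (by simp)

lemma map_one (h : IsTestFunction φ) : φ 1 = 0 := h.eq_zero_of_notMem (by simp)

lemma sub (h : IsTestFunction φ) (h' : IsTestFunction η) : IsTestFunction fun t => φ t - η t where
  smooth := h.smooth.sub h'.smooth
  hasCompactSupport := h.hasCompactSupport.sub h'.hasCompactSupport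
  tsupport_subset := (tsupport_sub φ η).trans (union_subset h.tsupport_subset h'.tsupport_subset)

lemma smul_const {φ : ℝ → ℝ} (h : IsTestFunction φ) (e : E) : IsTestFunction fun t => φ t • e where
  smooth := h.smooth.smul contDiff_const
  hasCompactSupport := h.hasCompactSupport.smul_right
  tsupport_subset := (tsupport_smul_subset_left φ fun _ => e).trans h.tsupport_subset

lemma mul_left {φ f : ℝ → ℝ} (h : IsTestFunction φ) (hf : ContDiff ℝ (⊤ : ℕ∞) f) :
    IsTestFunction fun t => φ t * f t where
  smooth := h.smooth.mul hf
  hasCompactSupport := h.hasCompactSupport.mul_right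
  tsupport_subset := (tsupport_mul_subset_left (f := φ) (g := f)).trans h.tsupport_subset

lemma hasDerivAt_primitive [CompleteSpace E] (h : IsTestFunction η) (t : ℝ) :
    HasDerivAt (fun t => ∫ s in (0 : ℝ)..t, η s) (η t) t :=
  (h.continuous.integral_hasStrictDerivAt 0 t).hasDerivAt

/-- A test function with vanishing integral is the derivative of a test function. -/
lemma primitive [CompleteSpace E] (h : IsTestFunction η)
    (h0 : ∫ t in (0 : ℝ)..1, η t = 0) : IsTestFunction fun t => ∫ s in (0 : ℝ)..t, η s := by
  -- The interval spanned by the support; for `η = 0` the pair `(1, 0)` encodes the empty interval.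
  obtain ⟨a, b, hab, hsub⟩ : ∃ a b : ℝ, Icc a b ⊆ Ioo 0 1 ∧ tsupport η ⊆ Icc a b := by
    rcases (tsupport η).eq_empty_or_nonempty with he | hne
    · exact ⟨1, 0, by simp, by simp [he]⟩
    · obtain ⟨a, ha, ha'⟩ := h.hasCompactSupport.isCompact.exists_isLeast hne
      obtain ⟨b, hb, hb'⟩ := h.hasCompactSupport.isCompact.exists_isGreatest hne
      exact ⟨a, b, Icc_subset_Ioo (h.tsupport_subset ha).1 (h.tsupport_subset hb).2,
        fun x hx => ⟨ha' hx, hb' hx⟩⟩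
  have hz : ∀ t ∉ Icc a b, η t = 0 := fun t ht =>
    image_eq_zero_of_notMem_tsupport fun h' => ht (hsub h')
  have hsupp : Function.support (fun t => ∫ s in (0 : ℝ)..t, η s) ⊆ Icc a b := by
    intro t ht
    by_contra hn
    refine ht ?_
    show ∫ s in (0 : ℝ)..t, η s = 0
    rw [mem_Icc, not_and_or, not_le, not_le] at hn
    have hi : ∀ x y, IntervalIntegrable η volume x y := fun x y =>
      h.continuous.intervalIntegrable x y
    by_cases hne : a ≤ b
    · have ha := hab (left_mem_Icc.2 hne)
      have hb := hab (right_mem_Icc.2 hne)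
      rcases hn with hn | hn
      · refine intervalIntegral.integral_zero_ae (ae_of_all _ fun s hs => hz s fun hs' => ?_)
        have := (mem_Ioc.1 hs).2.trans_lt (max_lt ha.1 hn)
        exact absurd hs'.1 (not_le.2 this)
      · have e : ∫ s in t..1, η s = 0 := by
          refine intervalIntegral.integral_zero_ae (ae_of_all _ fun s hs => hz s fun hs' => ?_)
          have := (lt_min hn hb.2).trans (mem_Ioc.1 hs).1
          exact absurd hs'.2 (not_le.2 this)
        rw [← intervalIntegral.integral_add_adjacent_intervals (hi 0 t) (hi t 1), e,
          add_zero] at h0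
        exact h0
    · exact intervalIntegral.integral_zero_ae
        (ae_of_all _ fun s _ => hz s fun hs' => hne (hs'.1.trans hs'.2))
  have hts : tsupport (fun t => ∫ s in (0 : ℝ)..t, η s) ⊆ Icc a b :=
    closure_minimal hsupp isClosed_Icc
  refine ⟨?_, HasCompactSupport.of_support_subset_isCompact isCompact_Icc hsupp, hts.trans hab⟩
  rw [contDiff_infty_iff_deriv]
  refine ⟨fun t => (h.hasDerivAt_primitive t).differentiableAt, ?_⟩
  have e : deriv (fun t => ∫ s in (0 : ℝ)..t, η s) = η :=
    funext fun t => (h.hasDerivAt_primitive t).deriv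
  rw [e]
  exact h.smooth

lemma integral_deriv [CompleteSpace E] (h : IsTestFunction φ) (t : ℝ) :
    ∫ s in (0 : ℝ)..t, deriv φ s = φ t := by
  rw [intervalIntegral.integral_deriv_eq_sub (fun s _ => h.differentiable s)
    (h.continuous_deriv.intervalIntegrable _ _), h.map_zero, sub_zero]

/-- Integration by parts against a test function. -/
lemma integral_deriv_smul [CompleteSpace E] {φ : ℝ → ℝ} {F F' : ℝ → E} (h : IsTestFunction φ)
    (hF : ∀ t, HasDerivAt F (F' t) t) (hF' : Continuous F') :
    ∫ t, deriv φ t • F t ∂unitMeasure = -∫ t, φ t • F' t ∂unitMeasure := by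
  have hFc : Continuous F := continuous_iff_continuousAt.2 fun t => (hF t).continuousAt
  have c1 : Continuous fun t => φ t • F' t := h.continuous.smul hF'
  have c2 : Continuous fun t => deriv φ t • F t := h.continuous_deriv.smul hFc
  have h1 := intervalIntegral.integral_eq_sub_of_hasDerivAt (a := 0) (b := 1)
    (fun t _ => (h.differentiable t).hasDerivAt.smul (hF t))
    ((c1.add c2).intervalIntegrable 0 1)
  rw [intervalIntegral.integral_add (c1.intervalIntegrable 0 1) (c2.intervalIntegrable 0 1)] at h1
  simp only [Pi.smul_apply', h.map_zero, h.map_one, zero_smul, sub_zero] at h1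
  rw [integral_unitMeasure, integral_unitMeasure]
  exact eq_neg_of_add_eq_zero_right h1

end IsTestFunction

lemma exists_isTestFunction_integral_one :
    ∃ ψ : ℝ → ℝ, IsTestFunction ψ ∧ ∫ t in (0 : ℝ)..1, ψ t = 1 := by
  let f : ContDiffBump (1 / 2 : ℝ) := ⟨1 / 8, 1 / 4, by norm_num, by norm_num⟩
  have hts : tsupport (f.normed volume) ⊆ Ioo (0 : ℝ) 1 := by
    rw [f.tsupport_normed_eq, Real.closedBall_eq_Icc]
    exact Icc_subset_Ioo (by norm_num [f]) (by norm_num [f])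
  refine ⟨f.normed volume, ⟨f.contDiff_normed, f.hasCompactSupport_normed, hts⟩, ?_⟩
  rw [intervalIntegral.integral_of_le zero_le_one, setIntegral_eq_integral_of_forall_compl_eq_zero,
    f.integral_normed]
  intro t ht
  exact image_eq_zero_of_notMem_tsupport fun h => ht (Ioo_subset_Ioc_self (hts h))

/-- Subtracting a multiple of a fixed test function makes the integral vanish. -/
lemma IsTestFunction.sub_mul_integral {η ψ : ℝ → ℝ} (hη : IsTestFunction η)
    (hψ : IsTestFunction ψ) (hψ1 : ∫ t in (0 : ℝ)..1, ψ t = 1) :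
    IsTestFunction (fun t => η t - ψ t * ∫ s in (0 : ℝ)..1, η s) ∧
      ∫ t in (0 : ℝ)..1, (η t - ψ t * ∫ s in (0 : ℝ)..1, η s) = 0 := by
  refine ⟨hη.sub (hψ.mul_left contDiff_const), ?_⟩
  have h1 : IntervalIntegrable (fun t => ψ t * ∫ s in (0 : ℝ)..1, η s) volume 0 1 :=
    (hψ.continuous.intervalIntegrable _ _).mul_const _
  rw [intervalIntegral.integral_sub (hη.continuous.intervalIntegrable _ _) h1,
    intervalIntegral.integral_mul_const, hψ1, one_mul, sub_self]

/-- The lemma of du Bois-Reymond. -/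
lemma exists_ae_eq_const_of_integral_deriv_smul [CompleteSpace E] {h : ℝ → E}
    (hi : Integrable h unitMeasure)
    (H : ∀ φ : ℝ → ℝ, IsTestFunction φ → ∫ t, deriv φ t • h t ∂unitMeasure = 0) :
    ∃ c : E, ∀ᵐ t ∂unitMeasure, h t = c := by
  obtain ⟨ψ, hψ, hψ1⟩ := exists_isTestFunction_integral_one
  have hint : ∀ η : ℝ → ℝ, IsTestFunction η → Integrable (fun t => η t • h t) unitMeasure := by
    intro η hη
    obtain ⟨C, hC⟩ := hη.hasCompactSupport.exists_bound_of_continuous hη.continuous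
    exact hi.bdd_smul C hη.continuous.aestronglyMeasurable (ae_of_all _ hC)
  -- For any test function `η`, the function `η - ψ ∫ η` has mean zero and so is the derivative of a
  -- test function. The hypothesis then reads `∫ η h = (∫ η) c`, which identifies `c` as the
  -- constant.
  set c := ∫ t, ψ t • h t ∂unitMeasure with hc
  refine ⟨c, ?_⟩
  have hloc : LocallyIntegrableOn (fun t => h t - c) (Ioo 0 1) := by
    have : IntegrableOn (fun t => h t - c) (Ioo 0 1) := hi.sub (integrable_const c)
    exact this.locallyIntegrableOn
  have key := isOpen_Ioo.ae_eq_zero_of_integral_contDiff_smul_eq_zero hloc (fun η h1 h2 h3 => by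
    have hη : IsTestFunction η := ⟨h1, h2, h3⟩
    set I := ∫ t in (0 : ℝ)..1, η t with hI
    obtain ⟨hζ, hζ0⟩ := hη.sub_mul_integral hψ hψ1
    rw [← hI] at hζ hζ0
    have h4 := H _ (hζ.primitive hζ0)
    have e : deriv (fun t => ∫ s in (0 : ℝ)..t, (η s - ψ s * I)) = fun t => η t - ψ t * I :=
      funext fun t => (hζ.hasDerivAt_primitive t).deriv
    have e2 : (fun t => (η t - ψ t * I) • h t) = fun t => η t • h t - I • (ψ t • h t) := by
      ext t
      rw [sub_smul, smul_smul, mul_comm]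
    rw [e] at h4
    simp only [e2] at h4
    have h6 : Integrable (fun t => I • (ψ t • h t)) unitMeasure := (hint ψ hψ).smul I
    rw [integral_sub (hint η hη) h6, integral_smul, ← hc] at h4
    have h5 : ∫ t, η t • (h t - c) = ∫ t, η t • (h t - c) ∂unitMeasure := by
      rw [unitMeasure, setIntegral_eq_integral_of_forall_compl_eq_zero]
      intro t ht
      rw [hη.eq_zero_of_notMem ht, zero_smul]
    rw [h5]
    simp only [smul_sub]
    rw [integral_sub (hint η hη) (hη.continuous.integrable_unitMeasure.smul_const c),
      integral_smul_const, integral_unitMeasure η]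
    exact h4)
  rw [unitMeasure, ae_restrict_iff' measurableSet_Ioo]
  filter_upwards [key] with t ht h' using sub_eq_zero.1 (ht h')

end TestFunctions

/-! ### Regularity: weak solutions are flows. -/

section WeakSolutions

variable {p q : ℝ}

lemma one_le_ofReal (hp : 1 ≤ p) : (1 : ENNReal) ≤ ENNReal.ofReal p := by
  rw [← ENNReal.ofReal_one]
  exact ENNReal.ofReal_le_ofReal hp

lemma tendsto_eLpNorm_one_of_tendsto_eLpNorm {F : Type*} [NormedAddCommGroup F] (hp : 1 ≤ p)
    {f : ℕ → ℝ → F}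
    (hf : ∀ n, AEStronglyMeasurable (f n) unitMeasure)
    (h : Tendsto (fun n => eLpNorm (f n) (ENNReal.ofReal p) unitMeasure) atTop (𝓝 0)) :
    Tendsto (fun n => eLpNorm (f n) 1 unitMeasure) atTop (𝓝 0) :=
  tendsto_of_tendsto_of_tendsto_of_le_of_le tendsto_const_nhds h (fun _ => zero_le)
    fun n => eLpNorm_le_eLpNorm_of_exponent_le (one_le_ofReal hp) (hf n)

/-- The continuous representative of an element of `W_0^{1,p}`. -/
lemma MemSobolevZero.exists_primitive [CompleteSpace E] {u g : ℝ → E}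
    (h : MemSobolevZero p u g) (hp : 1 ≤ p) :
    ∃ U : ℝ → E, Continuous U ∧ U 0 = 0 ∧ U 1 = 0 ∧ u =ᵐ[unitMeasure] U ∧
      ∀ t ∈ Icc (0 : ℝ) 1, U t = ∫ s in (0 : ℝ)..t, g s := by
  obtain ⟨φ, hφ, hφu, hφg⟩ := h.approx
  have hu1 := tendsto_eLpNorm_one_of_tendsto_eLpNorm hp
    (fun n => (hφ n).continuous.aestronglyMeasurable.sub h.memLp.1) hφu
  have hg1 := tendsto_eLpNorm_one_of_tendsto_eLpNorm hp
    (fun n => (hφ n).continuous_deriv.aestronglyMeasurable.sub h.memLp_deriv.1) hφg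
  have hgi : Integrable g unitMeasure := h.memLp_deriv.integrable (one_le_ofReal hp)
  have hgI : ∀ t ∈ Icc (0 : ℝ) 1, IntervalIntegrable g volume 0 t := fun t ht =>
    intervalIntegrable_of_integrable_unitMeasure hgi (by simp) ht
  set G : ℝ → E := (Ioc (0 : ℝ) 1).indicator g with hG
  have hGi : Integrable G := by
    have : IntegrableOn g (Ioc 0 1) := (integrableOn_Ioc_iff_integrableOn_Ioo).2 hgi
    exact this.integrable_indicator measurableSet_Ioc
  set U : ℝ → E := fun t => ∫ s in (0 : ℝ)..t, G s with hU
  have hUg : ∀ t ∈ Icc (0 : ℝ) 1, U t = ∫ s in (0 : ℝ)..t, g s := by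
    intro t ht
    refine intervalIntegral.integral_congr_ae (ae_of_all _ fun s hs => ?_)
    rw [uIoc_of_le ht.1] at hs
    exact indicator_of_mem (Ioc_subset_Ioc_right ht.2 hs) g
  -- Each `φ n` is the primitive of its derivative, so `L^1` convergence of the derivatives gives
  -- convergence of `φ n` to `U` at every point of `[0, 1]`. In particular `U 1 = 0`, the boundary
  -- condition encoded in the closure of the test functions.
  have hbound : ∀ t ∈ Icc (0 : ℝ) 1, ∀ n,
      ‖φ n t - U t‖ₑ ≤ eLpNorm (fun t => deriv (φ n) t - g t) 1 unitMeasure := by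
    intro t ht n
    rw [hUg t ht, ← (hφ n).integral_deriv t, ← intervalIntegral.integral_sub
      ((hφ n).continuous_deriv.intervalIntegrable _ _) (hgI t ht),
      intervalIntegral.integral_of_le ht.1, eLpNorm_one_eq_lintegral_enorm, unitMeasure,
      Measure.restrict_congr_set (Ioo_ae_eq_Ioc (μ := volume))]
    exact (enorm_integral_le_lintegral_enorm _).trans
      (lintegral_mono_set (Ioc_subset_Ioc_right ht.2))
  have hpt : ∀ t ∈ Icc (0 : ℝ) 1, Tendsto (fun n => φ n t) atTop (𝓝 (U t)) := by
    intro t ht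
    rw [tendsto_iff_edist_tendsto_0]
    simp only [edist_eq_enorm_sub]
    exact tendsto_of_tendsto_of_tendsto_of_le_of_le tendsto_const_nhds hg1 (fun _ => zero_le)
      (hbound t ht)
  refine ⟨U, intervalIntegral.continuous_primitive (fun a b => hGi.intervalIntegrable) 0,
    by simp [hU], ?_, ?_, hUg⟩
  · have h1 := hpt 1 (by simp)
    simp only [(hφ _).map_one] at h1
    exact (tendsto_nhds_unique h1 tendsto_const_nhds)
  · obtain ⟨ns, hns, hae⟩ := (tendstoInMeasure_of_tendsto_eLpNorm one_ne_zero
      (fun n => (hφ n).continuous.aestronglyMeasurable) h.memLp.1 hu1).exists_seq_tendsto_ae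
    filter_upwards [hae, ae_unitMeasure (P := fun t => t ∈ Ioo (0 : ℝ) 1) fun t ht => ht]
      with t ht ht'
    exact tendsto_nhds_unique ht ((hpt t (Ioo_subset_Icc_self ht')).comp hns.tendsto_atTop)

/-- Because `‖g‖^(p-1) ≤ 1 + ‖g‖^p` and the measure is finite. -/
lemma integrable_phi (hp : 1 < p) {g : ℝ → E} (hg : MemLp g (ENNReal.ofReal p) unitMeasure) :
    Integrable (fun t => phi p (g t)) unitMeasure := by
  have hp0 : 0 < p := by linarith
  have h1 : Integrable (fun t => ‖g t‖ ^ p) unitMeasure := by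
    have := hg.integrable_norm_rpow (by simpa using hp0) ENNReal.ofReal_ne_top
    rwa [ENNReal.toReal_ofReal hp0.le] at this
  refine ((integrable_const (1 : ℝ)).add h1).mono'
    ((continuous_phi hp).comp_aestronglyMeasurable hg.1) (ae_of_all _ fun t => ?_)
  rw [norm_phi hp, Pi.add_apply]
  rcases le_total ‖g t‖ 1 with h | h
  · have := Real.rpow_le_one (norm_nonneg (g t)) h (sub_pos.2 hp).le
    have := Real.rpow_nonneg (norm_nonneg (g t)) p
    linarith
  · have := Real.rpow_le_rpow_of_exponent_le h (sub_le_self p zero_le_one)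
    linarith

/-- The weak equation, tested with scalar functions. -/
lemma integral_deriv_smul_phi [CompleteSpace E] (hp : 1 < p) {Λ : ℝ} {u g U : ℝ → E}
    (h : MemSobolevZero p u g) (hU : u =ᵐ[unitMeasure] U)
    (heq : ∀ φ : ℝ → E, IsTestFunction φ →
      ∫ t, inner ℝ (phi p (g t)) (deriv φ t) ∂unitMeasure =
        Λ * ∫ t, inner ℝ (phi p (u t)) (φ t) ∂unitMeasure)
    {φ : ℝ → ℝ} (hφ : IsTestFunction φ) :
    ∫ t, deriv φ t • phi p (g t) ∂unitMeasure = Λ • ∫ t, φ t • phi p (U t) ∂unitMeasure := by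
  have hbdd : ∀ {η : ℝ → ℝ} {v : ℝ → E}, Continuous η → HasCompactSupport η →
      Integrable v unitMeasure → Integrable (fun t => η t • v t) unitMeasure := by
    intro η v hη hc hv
    obtain ⟨C, hC⟩ := hc.exists_bound_of_continuous hη
    exact hv.bdd_smul C hη.aestronglyMeasurable (ae_of_all _ hC)
  have hi1 := hbdd hφ.continuous_deriv hφ.hasCompactSupport.deriv (integrable_phi hp h.memLp_deriv)
  have hi2 := hbdd hφ.continuous hφ.hasCompactSupport (integrable_phi hp h.memLp)
  have e : ∫ t, φ t • phi p (U t) ∂unitMeasure = ∫ t, φ t • phi p (u t) ∂unitMeasure := by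
    refine integral_congr_ae ?_
    filter_upwards [hU] with t ht
    rw [ht]
  rw [e]
  -- The vector identity is tested against each fixed `v`, which is the weak equation for the test
  -- function `φ v`.
  refine ext_inner_left ℝ fun v => ?_
  rw [← integral_inner hi1, inner_smul_right, ← integral_inner hi2]
  have := heq _ (hφ.smul_const v)
  simp only [deriv_smul_const (hφ.differentiable _), inner_smul_right] at this
  simp only [inner_smul_right]
  simp only [real_inner_comm _ v]
  exact this

/-- A weak solution agrees almost everywhere with a flow on `[0, 1]`. -/
lemma IsWeakSolution.exists_isFlow [CompleteSpace E] {Λ : ℝ} {u : ℝ → E}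
    (h : IsWeakSolution p Λ u) (hp : 1 < p) (hq : 1 < q) (hpq : (p - 1) * (q - 1) = 1) :
    ∃ U w : ℝ → E, IsFlow p q 1 Λ U w 0 1 ∧ U 0 = 0 ∧ U 1 = 0 ∧ u =ᵐ[unitMeasure] U := by
  obtain ⟨g, hS, heq⟩ := h
  obtain ⟨U, hUc, hU0, hU1, huU, hUg⟩ := hS.exists_primitive hp.le
  have hF : Continuous fun t => -(Λ • phi p (U t)) :=
    (((continuous_phi hp).comp hUc).const_smul Λ).neg
  set W : ℝ → E := fun t => ∫ s in (0 : ℝ)..t, -(Λ • phi p (U s)) with hW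
  have hW' : ∀ t, HasDerivAt W (-(Λ • phi p (U t))) t := fun t =>
    (hF.integral_hasStrictDerivAt 0 t).hasDerivAt
  have hWc : Continuous W := continuous_iff_continuousAt.2 fun t => (hW' t).continuousAt
  -- The weak equation says that `phi p g` and `W` have the same weak derivative. Hence `phi p g = W
  -- + c` almost everywhere, and inverting `phi p` shows that `g` has a continuous representative.
  obtain ⟨c, hc⟩ := exists_ae_eq_const_of_integral_deriv_smul
    (h := fun t => phi p (g t) - W t)
    ((integrable_phi hp hS.memLp_deriv).sub hWc.integrable_unitMeasure) (fun φ hφ => by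
      obtain ⟨C, hC⟩ := hφ.hasCompactSupport.deriv.exists_bound_of_continuous hφ.continuous_deriv
      have hi : Integrable (fun t => deriv φ t • phi p (g t)) unitMeasure :=
        (integrable_phi hp hS.memLp_deriv).bdd_smul C hφ.continuous_deriv.aestronglyMeasurable
          (ae_of_all _ hC)
      simp only [smul_sub]
      have hi' : Integrable (fun t => deriv φ t • W t) unitMeasure :=
        (hφ.continuous_deriv.smul hWc).integrable_unitMeasure
      rw [integral_sub hi hi',
        integral_deriv_smul_phi hp hS huU heq hφ, hφ.integral_deriv_smul hW' hF]
      simp only [smul_neg, smul_comm _ Λ]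
      rw [integral_neg, integral_smul, neg_neg, sub_self])
  have hg : g =ᵐ[unitMeasure] fun t => phi q (W t + c) := by
    filter_upwards [hc] with t ht
    rw [← ht, add_sub_cancel, phi_phi_cancel (by rw [mul_comm]; exact hpq)]
  have hwc : Continuous fun t => phi q (W t + c) :=
    (continuous_phi hq).comp (hWc.add continuous_const)
  have hUV : ∀ t ∈ Icc (0 : ℝ) 1, U t = ∫ s in (0 : ℝ)..t, phi q (W s + c) := by
    intro t ht
    rw [hUg t ht]
    refine intervalIntegral.integral_congr_ae ?_
    rw [unitMeasure, Measure.restrict_congr_set (Ioo_ae_eq_Ioc (μ := volume)), EventuallyEq,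
      ae_restrict_iff' measurableSet_Ioc] at hg
    filter_upwards [hg] with s hs hs'
    rw [uIoc_of_le ht.1] at hs'
    exact hs (Ioc_subset_Ioc_right ht.2 hs')
  refine ⟨U, fun t => W t + c, ⟨hUc.continuousOn, (hWc.add continuous_const).continuousOn,
    fun t ht => ?_, fun t _ => ((hW' t).add_const c).hasDerivWithinAt⟩, hU0, hU1, huU⟩
  rw [one_smul]
  refine (hwc.integral_hasStrictDerivAt 0 t).hasDerivAt.hasDerivWithinAt.congr_of_eventuallyEq ?_
    (hUV t (Ico_subset_Icc_self ht))
  filter_upwards [Ico_mem_nhdsGE ht.2] with s hs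
  exact hUV s ⟨ht.1.trans hs.1, hs.2.le⟩

end WeakSolutions

/-! ### The rescaled profile as a weak solution. -/

section WeakConverse

variable {p q : ℝ}

lemma tendsto_eLpNorm_of_bounded (hp : 0 < p) {f : ℕ → ℝ → ℝ} {C : ℝ}
    (hf : ∀ n, AEStronglyMeasurable (f n) unitMeasure)
    (hC : ∀ n, ∀ t ∈ Ioo (0 : ℝ) 1, ‖f n t‖ ≤ C)
    (hlim : ∀ t ∈ Ioo (0 : ℝ) 1, Tendsto (fun n => f n t) atTop (𝓝 0)) :
    Tendsto (fun n => eLpNorm (f n) (ENNReal.ofReal p) unitMeasure) atTop (𝓝 0) := by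
  have hp' : ENNReal.ofReal p ≠ 0 := by simpa using hp
  simp only [eLpNorm_eq_lintegral_rpow_enorm_toReal hp' ENNReal.ofReal_ne_top,
    ENNReal.toReal_ofReal hp.le]
  have h1 : Tendsto (fun n => ∫⁻ t, ‖f n t‖ₑ ^ p ∂unitMeasure) atTop
      (𝓝 (∫⁻ _, 0 ∂unitMeasure)) := by
    refine tendsto_lintegral_of_dominated_convergence' (fun _ => ENNReal.ofReal C ^ p)
      (fun n => (hf n).enorm.pow_const p) (fun n => ae_unitMeasure fun t ht => ?_) ?_
      (ae_unitMeasure fun t ht => ?_)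
    · refine ENNReal.rpow_le_rpow ?_ hp.le
      rw [← ofReal_norm]
      exact ENNReal.ofReal_le_ofReal (hC n t ht)
    · rw [lintegral_const, measure_univ, mul_one]
      exact ENNReal.rpow_ne_top_of_nonneg hp.le ENNReal.ofReal_ne_top
    · have h2 := (hlim t ht).enorm
      rw [enorm_zero] at h2
      have := (ENNReal.continuous_rpow_const (y := p)).continuousAt.tendsto.comp h2
      rwa [ENNReal.zero_rpow_of_pos hp] at this
  rw [lintegral_zero] at h1
  have h3 := (ENNReal.continuous_rpow_const (y := 1 / p)).continuousAt.tendsto.comp h1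
  rwa [ENNReal.zero_rpow_of_pos (by positivity)] at h3

lemma exists_cutoff {δ : ℝ} (h0 : 0 < δ) (h1 : δ < 1 / 2) :
    ∃ χ : ℝ → ℝ, IsTestFunction χ ∧ (∀ t, ‖χ t‖ ≤ 1) ∧ ∀ t ∈ Icc δ (1 - δ), χ t = 1 := by
  let f : ContDiffBump (1 / 2 : ℝ) := ⟨1 / 2 - δ, 1 / 2 - δ / 2, by linarith, by linarith⟩
  refine ⟨f, ⟨f.contDiff, f.hasCompactSupport, ?_⟩, fun t => ?_, fun t ht => ?_⟩
  · rw [f.tsupport_eq, Real.closedBall_eq_Icc]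
    exact Icc_subset_Ioo (by simp only [f]; linarith) (by simp only [f]; linarith)
  · rw [Real.norm_of_nonneg f.nonneg]
    exact f.le_one
  · refine f.one_of_mem_closedBall ?_
    rw [Real.closedBall_eq_Icc]
    exact ⟨by simp only [f]; linarith [ht.1], by simp only [f]; linarith [ht.2]⟩

/-- Continuous functions are bounded pointwise limits of test functions. -/
lemma exists_isTestFunction_tendsto {G : ℝ → ℝ} (hG : Continuous G) :
    ∃ (η : ℕ → ℝ → ℝ) (C : ℝ), (∀ n, IsTestFunction (η n)) ∧
      (∀ n, ∀ t ∈ Icc (0 : ℝ) 1, ‖η n t‖ ≤ C) ∧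
      ∀ t ∈ Ioo (0 : ℝ) 1, Tendsto (fun n => η n t) atTop (𝓝 (G t)) := by
  obtain ⟨C, hC⟩ := isCompact_Icc.exists_bound_of_continuousOn (s := Icc (0 : ℝ) 1) hG.continuousOn
  have hε : ∀ n : ℕ, (0 : ℝ) < 1 / ((n : ℝ) + 1) := fun n => Nat.one_div_pos_of_nat
  have hle : ∀ n : ℕ, 1 / ((n : ℝ) + 1) ≤ 1 := fun n => by
    rw [div_le_one (by positivity)]
    linarith [n.cast_nonneg (α := ℝ)]
  choose P hP using fun n : ℕ =>
    exists_polynomial_near_of_continuousOn 0 1 G hG.continuousOn _ (hε n)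
  -- Weierstrass polynomials are smooth but not compactly supported, so each is multiplied by a
  -- cutoff whose plateau fills `(0, 1)` as `n` grows.
  choose χ hχ hχ1 hχ2 using fun n : ℕ => exists_cutoff (δ := 1 / ((n : ℝ) + 1) / 4)
    (by have := hε n; positivity) (by linarith [hle n])
  have hPG : ∀ t ∈ Icc (0 : ℝ) 1, Tendsto (fun n => (P n).eval t) atTop (𝓝 (G t)) := by
    intro t ht
    rw [tendsto_iff_dist_tendsto_zero]
    exact squeeze_zero (fun _ => dist_nonneg) (fun n => (hP n t ht).le)
      tendsto_one_div_add_atTop_nhds_zero_nat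
  refine ⟨fun n t => χ n t * (P n).eval t, C + 1, fun n => (hχ n).mul_left (by
    simpa using (P n).contDiff_aeval (𝕜 := ℝ) (⊤ : ℕ∞)),
    fun n t ht => ?_, fun t ht => ?_⟩
  · have h1 : ‖(P n).eval t‖ ≤ C + 1 := by
      have h2 := norm_sub_norm_le ((P n).eval t) (G t)
      have h3 : ‖(P n).eval t - G t‖ < _ := hP n t ht
      linarith [hC t ht, hle n]
    rw [norm_mul]
    calc ‖χ n t‖ * ‖(P n).eval t‖ ≤ 1 * ‖(P n).eval t‖ :=
          mul_le_mul_of_nonneg_right (hχ1 n t) (norm_nonneg _)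
      _ ≤ C + 1 := by rwa [one_mul]
  · refine (hPG t (Ioo_subset_Icc_self ht)).congr' ?_
    have hsmall : ∀ᶠ n : ℕ in atTop, 1 / ((n : ℝ) + 1) < min t (1 - t) :=
      tendsto_one_div_add_atTop_nhds_zero_nat.eventually_lt_const
        (lt_min ht.1 (sub_pos.2 ht.2))
    filter_upwards [hsmall] with n hn
    have h1 := hn.trans_le (min_le_left _ _)
    have h2 := hn.trans_le (min_le_right _ _)
    have h3 := hε n
    rw [hχ2 n t ⟨by linarith, by linarith⟩, one_mul]

lemma tendsto_integral_of_bounded {η : ℕ → ℝ → ℝ} {G : ℝ → ℝ} {C : ℝ}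
    (hη : ∀ n, Continuous (η n)) (hC : ∀ n, ∀ t ∈ Icc (0 : ℝ) 1, ‖η n t‖ ≤ C)
    (hlim : ∀ t ∈ Ioo (0 : ℝ) 1, Tendsto (fun n => η n t) atTop (𝓝 (G t))) {t : ℝ}
    (ht : t ∈ Icc (0 : ℝ) 1) :
    Tendsto (fun n => ∫ s in (0 : ℝ)..t, η n s) atTop (𝓝 (∫ s in (0 : ℝ)..t, G s)) := by
  refine intervalIntegral.tendsto_integral_filter_of_dominated_convergence (fun _ => C)
    (Eventually.of_forall fun n => (hη n).aestronglyMeasurable)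
    (Eventually.of_forall fun n => ae_of_all _ fun s hs => ?_) intervalIntegrable_const ?_
  · rw [uIoc_of_le ht.1] at hs
    exact hC n s ⟨hs.1.le, hs.2.trans ht.2⟩
  · filter_upwards [compl_mem_ae_iff.2 (measure_singleton (1 : ℝ))] with s hs1 hs
    rw [uIoc_of_le ht.1] at hs
    exact hlim s ⟨hs.1, lt_of_le_of_ne (hs.2.trans ht.2) hs1⟩

/-- A `C^1` function which vanishes at `0` and `1` belongs to `W_0^{1,p}`. -/
lemma memSobolevZero_of_hasDerivAt (hp : 0 < p) {U G : ℝ → ℝ} (hU : ∀ t, HasDerivAt U (G t) t)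
    (hG : Continuous G) (h0 : U 0 = 0) (h1 : U 1 = 0) : MemSobolevZero p U G := by
  have hUc : Continuous U := continuous_iff_continuousAt.2 fun t => (hU t).continuousAt
  have hUG : ∀ t, U t = ∫ s in (0 : ℝ)..t, G s := fun t => by
    rw [intervalIntegral.integral_eq_sub_of_hasDerivAt (fun s _ => hU s)
      (hG.intervalIntegrable _ _), h0, sub_zero]
  obtain ⟨η, C, hη, hηC, hηG⟩ := exists_isTestFunction_tendsto hG
  obtain ⟨ψ, hψ, hψ1⟩ := exists_isTestFunction_integral_one
  obtain ⟨D, hD⟩ := hψ.hasCompactSupport.exists_bound_of_continuous hψ.continuous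
  obtain ⟨B, hB⟩ := isCompact_Icc.exists_bound_of_continuousOn (s := Icc (0 : ℝ) 1) hG.continuousOn
  -- `U 0 = U 1 = 0` means that `G` has mean zero, so the means of `η n` tend to zero. Removing them
  -- with `ψ` does not change the limit and makes the primitives test functions.
  set ζ : ℕ → ℝ → ℝ := fun n t => η n t - ψ t * ∫ s in (0 : ℝ)..1, η n s with hζdef
  have hζ : ∀ n, IsTestFunction (ζ n) ∧ ∫ t in (0 : ℝ)..1, ζ n t = 0 := fun n =>
    (hη n).sub_mul_integral hψ hψ1
  have hI : Tendsto (fun n => ∫ s in (0 : ℝ)..1, η n s) atTop (𝓝 0) := by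
    have := tendsto_integral_of_bounded (fun n => (hη n).continuous) hηC hηG (t := 1) (by simp)
    rwa [← hUG, h1] at this
  have hζG : ∀ t ∈ Ioo (0 : ℝ) 1, Tendsto (fun n => ζ n t) atTop (𝓝 (G t)) := fun t ht => by
    simpa using (hηG t ht).sub (hI.const_mul (ψ t))
  have hint : ∀ {f : ℝ → ℝ} {K : ℝ}, (∀ t ∈ Icc (0 : ℝ) 1, ‖f t‖ ≤ K) → ∀ t ∈ Icc (0 : ℝ) 1,
      ‖∫ s in (0 : ℝ)..t, f s‖ ≤ K := by
    intro f K hK t ht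
    have h2 := intervalIntegral.norm_integral_le_of_norm_le_const (a := 0) (b := t) (f := f)
      (C := K) (fun s hs => by
        rw [uIoc_of_le ht.1] at hs
        exact hK s ⟨hs.1.le, hs.2.trans ht.2⟩)
    rw [sub_zero, abs_of_nonneg ht.1] at h2
    exact h2.trans (mul_le_of_le_one_right ((norm_nonneg _).trans (hK t ht)) ht.2)
  have hζC : ∀ n, ∀ t ∈ Icc (0 : ℝ) 1, ‖ζ n t‖ ≤ C + D * C := by
    intro n t ht
    refine (norm_sub_le _ _).trans (add_le_add (hηC n t ht) ?_)
    rw [norm_mul]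
    exact mul_le_mul (hD t) (hint (hηC n) 1 (by simp)) (norm_nonneg _)
      ((norm_nonneg _).trans (hD t))
  have hder : ∀ n, deriv (fun t => ∫ s in (0 : ℝ)..t, ζ n s) = ζ n := fun n =>
    funext fun t => ((hζ n).1.hasDerivAt_primitive t).deriv
  refine ⟨hUc.memLp_unitMeasure _, hG.memLp_unitMeasure _,
    ⟨hUc.locallyIntegrable.locallyIntegrableOn _, hG.locallyIntegrable.locallyIntegrableOn _,
      fun φ hφ => hφ.integral_deriv_smul hU hG⟩,
    fun n t => ∫ s in (0 : ℝ)..t, ζ n s, fun n => (hζ n).1.primitive (hζ n).2, ?_, ?_⟩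
  · refine tendsto_eLpNorm_of_bounded (C := C + D * C + B) hp
      (fun n => (((hζ n).1.primitive (hζ n).2).continuous.sub hUc).aestronglyMeasurable)
      (fun n t ht => ?_) fun t ht => ?_
    · have ht' := Ioo_subset_Icc_self ht
      refine (norm_sub_le _ _).trans (add_le_add (hint (hζC n) t ht') ?_)
      rw [hUG]
      exact hint hB t ht'
    · have := tendsto_integral_of_bounded (fun n => (hζ n).1.continuous) hζC hζG
        (Ioo_subset_Icc_self ht)
      rw [← hUG] at this
      simpa using this.sub_const (U t)
  · simp only [hder]
    refine tendsto_eLpNorm_of_bounded (C := C + D * C + B) hp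
      (fun n => ((hζ n).1.continuous.sub hG).aestronglyMeasurable)
      (fun n t ht => ?_) fun t ht => ?_
    · have ht' := Ioo_subset_Icc_self ht
      exact (norm_sub_le _ _).trans (add_le_add (hζC n t ht') (hB t ht'))
    · simpa using (hζG t ht).sub_const (G t)

/-- Along a flow `phi p (u')` is `w`, which is `C^1`, so the weak equation is an ordinary
integration by parts. -/
lemma IsGlobalFlow.isWeakSolution {β : ℝ} {u w : ℝ → ℝ} (h : IsGlobalFlow p q β u w) (hp : 1 < p)
    (hq : 1 < q) (hpq : (p - 1) * (q - 1) = 1) (h0 : u 0 = 0) (h1 : u 1 = 0) :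
    IsWeakSolution p β u := by
  refine ⟨fun t => phi q (w t), memSobolevZero_of_hasDerivAt (by linarith) h.deriv_fst
    ((continuous_phi hq).comp h.continuous_snd) h0 h1, fun φ hφ => ?_⟩
  have hF : Continuous fun t => -(β • phi p (u t)) :=
    (((continuous_phi hp).comp h.continuous_fst).const_smul β).neg
  have key := hφ.integral_deriv_smul h.deriv_snd hF
  have e : ∀ t, φ t * -(β * phi p (u t)) = -(β * (φ t * phi p (u t))) := fun t => by ring
  simp only [smul_eq_mul, e, integral_neg, integral_const_mul, neg_neg] at key
  simpa only [phi_phi_cancel hpq, RCLike.inner_apply, conj_trivial] using key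

end WeakConverse

/-! ### Eigenvalues, profiles and the conclusion. -/

lemma exists_conj {p : ℝ} (hp : 1 < p) : ∃ q : ℝ, 1 < q ∧ (p - 1) * (q - 1) = 1 := by
  have : 0 < p - 1 := sub_pos.2 hp
  refine ⟨1 + (p - 1)⁻¹, by simpa using this, ?_⟩
  field_simp
  ring

/-- The conclusions that the classical and the weak problem share. -/
lemma IsFlow.eigenvalue_and_profile {E : Type*} [NormedAddCommGroup E] [InnerProductSpace ℝ E]
    {p q Λ : ℝ} {ω : ℝ → ℝ} (hω : IsOmega p ω)
    (hp : 1 < p) (hq : 1 < q) (hpq : (p - 1) * (q - 1) = 1) (hΛ : 0 < Λ) {u w : ℝ → E}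
    (h : IsFlow p q 1 Λ u w 0 1) (h0 : u 0 = 0) (h1 : u 1 = 0)
    (hne : ∃ t ∈ Icc (0 : ℝ) 1, u t ≠ 0) :
    (∃ k : ℕ, 0 < k ∧ Λ = (k : ℝ) ^ p * lam p) ∧
    (∃ c : E, ∀ t ∈ Icc (0 : ℝ) 1, u t = ω (Λ ^ (1 / p) * t) • ((Λ ^ (1 / p))⁻¹ • c)) ∧
    IsClassicalSolution p Λ (fun t : ℝ => ω (Λ ^ (1 / p) * t)) ∧
    IsWeakSolution p Λ (fun t : ℝ => ω (Λ ^ (1 / p) * t)) := by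
  set μ := Λ ^ (1 / p) with hμdef
  have hμ : 0 < μ := Real.rpow_pos_of_pos hΛ _
  have hμp : μ ^ p = Λ := by
    rw [hμdef, ← Real.rpow_mul hΛ.le, one_div_mul_cancel (by linarith), Real.rpow_one]
  rw [← hμp] at h ⊢
  obtain ⟨c, hc⟩ := h.exists_eq_smul_omega hω hp hq hpq hμ h0
  -- A nontrivial `u` has `c ≠ 0`, so the boundary condition at `1` passes to `ω`.
  have hωμ : ω μ = 0 := by
    obtain ⟨t, ht, htne⟩ := hne
    have hc0 : μ⁻¹ • c ≠ 0 := fun hz => htne (by rw [hc t ht, hz, smul_zero])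
    have h2 := hc 1 (by simp)
    rw [h1, mul_one] at h2
    exact (smul_eq_zero.1 h2.symm).resolve_right hc0
  -- Taking the scalar amplitude `μ` cancels the factor `μ⁻¹`, which leaves exactly `ω(μ t)`.
  have hs := (hω.isGlobalFlow hpq).rescale hpq hμ μ
  simp only [smul_eq_mul, inv_mul_cancel₀ hμ.ne', mul_one] at hs
  have hs0 : ω (μ * 0) = 0 := by rw [mul_zero, hω.zero]
  have hs1 : ω (μ * 1) = 0 := by rw [mul_one, hωμ]
  exact ⟨hω.exists_pow_mul_lam hp hq hpq hμ hωμ, ⟨c, hc⟩, hs.isClassicalSolution hpq hs0 hs1,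
    hs.isWeakSolution hp hq hpq hs0 hs1⟩

end VectorPLaplace

theorem corollary3p3 (p : ℝ) (hp : 1 < p) :
    (∃! ω : ℝ → ℝ, VectorPLaplace.IsOmega p ω) ∧
    ∀ ω : ℝ → ℝ, VectorPLaplace.IsOmega p ω → ∀ (N : ℕ) (Λ : ℝ), 0 < Λ →
      (∀ u : ℝ → EuclideanSpace ℝ (Fin N),
        VectorPLaplace.IsClassicalSolution p Λ u → (∃ t ∈ Set.Icc (0 : ℝ) 1, u t ≠ 0) →
          (∃ k : ℕ, 0 < k ∧ Λ = (k : ℝ) ^ p * VectorPLaplace.lam p) ∧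
          (∃ c : EuclideanSpace ℝ (Fin N), ∀ t ∈ Set.Icc (0 : ℝ) 1,
            u t = ω (Λ ^ (1 / p) * t) • ((Λ ^ (1 / p))⁻¹ • c)) ∧
          VectorPLaplace.IsClassicalSolution p Λ (fun t : ℝ => ω (Λ ^ (1 / p) * t))) ∧
      (∀ u : ℝ → EuclideanSpace ℝ (Fin N),
        VectorPLaplace.IsWeakSolution p Λ u → ¬ (u =ᵐ[VectorPLaplace.unitMeasure] 0) →
          (∃ k : ℕ, 0 < k ∧ Λ = (k : ℝ) ^ p * VectorPLaplace.lam p) ∧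
          (∃ c : EuclideanSpace ℝ (Fin N), ∀ᵐ t ∂VectorPLaplace.unitMeasure,
            u t = ω (Λ ^ (1 / p) * t) • ((Λ ^ (1 / p))⁻¹ • c)) ∧
          VectorPLaplace.IsWeakSolution p Λ (fun t : ℝ => ω (Λ ^ (1 / p) * t))) := by
  obtain ⟨q, hq, hpq⟩ := VectorPLaplace.exists_conj hp
  refine ⟨VectorPLaplace.existsUnique_isOmega hp hq hpq, fun ω hω N Λ hΛ =>
    ⟨fun u hu hne => ?_, fun u hu hne => ?_⟩⟩
  · obtain ⟨w, hw⟩ := hu.exists_isFlow hp hq hpq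
    obtain ⟨h1, h2, h3, -⟩ := hw.eigenvalue_and_profile hω hp hq hpq hΛ hu.left hu.right hne
    exact ⟨h1, h2, h3⟩
  · obtain ⟨U, w, hw, hU0, hU1, hU⟩ := hu.exists_isFlow hp hq hpq
    have hne' : ∃ t ∈ Icc (0 : ℝ) 1, U t ≠ 0 := by
      by_contra! hz
      exact hne (hU.trans (VectorPLaplace.ae_unitMeasure fun t ht => hz t (Ioo_subset_Icc_self ht)))
    obtain ⟨h1, ⟨c, hc⟩, -, h4⟩ := hw.eigenvalue_and_profile hω hp hq hpq hΛ hU0 hU1 hne'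
    refine ⟨h1, ⟨c, ?_⟩, h4⟩
    filter_upwards [hU, VectorPLaplace.ae_unitMeasure (P := fun t => t ∈ Ioo (0 : ℝ) 1)
      fun t ht => ht] with t ht ht'
    rw [ht, hc t (Ioo_subset_Icc_self ht')]
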